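/- There is a universal constant $L\in(0,\infty)$ such that the following holds. Let $n\ge 0$ be an integer, let $p\ge 2$ be real, let $A=(a_{ijk})_{1\le i,j,k\le n}$ be an array of real numbers, and let $g_1,\dots,g_n$ be independent standard Gaussian random variables. Let $B_1^n$ and $B_2^n$ be the closed unit balls of $\ell_1^n$ and $\ell_2^n$, let $$T\subset (B_2^n+\sqrt p\,B_1^n)\times(B_2^n+\sqrt p\,B_1^n)$$ be any set, and put $$\Delta_A(T)=\sup\Big\{\Big(\sum_k\Big(\sum_{ij}a_{ijk}(x_iy_j-\tilde x_i\tilde y_j)\Big)^2\Big)^{1/2}\colon (x,y),(\tilde x,\tilde y)\in T\Big\},$$ $$s_2^T(A)=\sup_{(x,y)\in T}\Big[\Big(\sum_{jk}\Big(\sum_i a_{ijk}x_i\Big)^2\Big)^{1/2}+\Big(\sum_{ik}\Big(\sum_j a_{ijk}y_j\Big)^2\Big)^{1/2}\Big]$$ (suprema over the empty set are read as $0$). Then $\sup_{(x,y)\in T}\sum_{ijk}a_{ijk}x_iy_jg_k$ is integrable and $$\mathbb E\sup_{(x,y)\in T}\sum_{ijk}a_{ijk}x_iy_jg_k\le L\Big[\sqrt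 p\,\Delta_A(T)+s_2^T(A)+\frac1{\sqrt p}\Big(\sum_{ijk}a_{ijk}^2\Big)^{1/2}\Big].$$ -/

import Mathlib

open MeasureTheory ProbabilityTheory
open scoped Pointwise

noncomputable section

namespace GaussianChaos

/-- The closed unit ball of `ℓ₂ⁿ`. -/
def ballTwo (n : ℕ) : Set (Fin n → ℝ) := {x | √(∑ i, x i ^ 2) ≤ 1}

/-- The closed unit ball of `ℓ₁ⁿ`. -/
def ballOne (n : ℕ) : Set (Fin n → ℝ) := {x | ∑ i, |x i| ≤ 1}

/-- The Minkowski sum `B₂ⁿ + √p B₁ⁿ`. -/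
def sumBall (n : ℕ) (p : ℝ) : Set (Fin n → ℝ) := ballTwo n + √p • ballOne n

/-- `Δ_A(T)`: the supremum over `(x,y), (x',y') ∈ T` of
`(∑ₖ (∑ᵢⱼ aᵢⱼₖ (xᵢ yⱼ - x'ᵢ y'ⱼ))²)^{1/2}`. -/
def diam {n : ℕ} (a : Fin n → Fin n → Fin n → ℝ)
    (T : Set ((Fin n → ℝ) × (Fin n → ℝ))) : ℝ :=
  ⨆ q : T × T, √(∑ k, (∑ i, ∑ j, a i j k *
    (q.1.1.1 i * q.1.1.2 j - q.2.1.1 i * q.2.1.2 j)) ^ 2)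

/-- `s₂ᵀ(A)`: the supremum over `(x,y) ∈ T` of
`(∑ⱼₖ (∑ᵢ aᵢⱼₖ xᵢ)²)^{1/2} + (∑ᵢₖ (∑ⱼ aᵢⱼₖ yⱼ)²)^{1/2}`. -/
def sTwo {n : ℕ} (a : Fin n → Fin n → Fin n → ℝ)
    (T : Set ((Fin n → ℝ) × (Fin n → ℝ))) : ℝ :=
  ⨆ z : T, (√(∑ j, ∑ k, (∑ i, a i j k * z.1.1 i) ^ 2) +
    √(∑ i, ∑ k, (∑ j, a i j k * z.1.2 j) ^ 2))

/-- The Hilbert–Schmidt norm `(∑ᵢⱼₖ aᵢⱼₖ²)^{1/2}`. -/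
def hsNorm {n : ℕ} (a : Fin n → Fin n → Fin n → ℝ) : ℝ :=
  √(∑ i, ∑ j, ∑ k, a i j k ^ 2)

/-- `sup_{(x,y) ∈ T} ∑ᵢⱼₖ aᵢⱼₖ xᵢ yⱼ gₖ` for a fixed vector `g`. -/
def supForm {n : ℕ} (a : Fin n → Fin n → Fin n → ℝ)
    (T : Set ((Fin n → ℝ) × (Fin n → ℝ))) (g : Fin n → ℝ) : ℝ :=
  ⨆ z : T, ∑ i, ∑ j, ∑ k, a i j k * z.1.1 i * z.1.2 j * g k

end GaussianChaos

end

/-! The bound is proved by chaining over partitions, with covering numbers obtained from a packing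
argument in measure. Let μ be the product of laws with density proportional to 1/cosh. On symmetric
sets, translation by x costs at most the factor ∏ cosh xₖ (`sechPi_translate_ge`). Since cosh(u+v) ≤
exp(u²/2+|v|), the cost for a point of t⁻¹(B₂ + r B₁) is at most exp(t⁻²/2 + r/t), so a single
measure handles the ℓ₂ and ℓ₁ directions together. Second moments under μ are squared
Hilbert–Schmidt norms up to the variance, so by Chebyshev ‖Hz‖ is of the order of the
Hilbert–Schmidt norm of H on a set of mass at least 1/2. Packing translates of such sets yields 2e^κ
pieces on which Hx varies by O(t‖H‖_HS) (`coveredBy_linear`). Under μ⊗μ the same works jointly for x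
↦ A(x,·), y ↦ A(·,y) and A(x,y) (`coveredBy_bilinear`).

Gaussian concentration then shows that a union of e^q families, of total diameter D, has width at
most the largest of their widths plus 3√q D (`width_le_of_coveredBy`).

For the scheme itself, let (c,d) be the current centre, a ≥ ‖A‖_HS, h a bound for the
Hilbert–Schmidt norms of A(x-c,·) and A(·,y-d), D the diameter, and t ≤ 1/r. Cut into e^{O(t⁻²)}
pieces and recentre each at one of its points (x⁰,y⁰): A(x-c,y-d) = A(x-x⁰,y-y⁰) + A(x,y⁰-d) +
A(x⁰-c,y) + const. In the two linear terms the ℓ₂ parts have width at most h, and the ℓ₁ parts have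
width O(h) after a further cut into e^{O(r²)} pieces, which Dudley chaining provides. The step costs
O(h + D/t) and leaves h' = O(ta), D' = O(th + t²a). Hence a bound of the form h + D/t + ta
reproduces itself when t is halved (`width_bilinear_step`, `width_bilinear_le`). Starting at t = r⁻¹
= 1/√p, it is the asserted inequality. -/

noncomputable section

namespace GaussianChaos

/-! ### Finite covers by subfamilies -/

/-- The finite family `T` is covered by at most `N` nonempty subfamilies with property `Q`. -/
def CoveredBy {ι : Type*} (T : Finset ι) (N : ℝ) (Q : Finset ι → Prop) : Prop :=
  ∃ C : Finset (Finset ι), (C.card : ℝ) ≤ N ∧ (∀ i ∈ T, ∃ S ∈ C, i ∈ S) ∧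
    ∀ S ∈ C, S ⊆ T ∧ S.Nonempty ∧ Q S

section Covers

variable {ι : Type*} {T : Finset ι} {N M : ℝ} {Q R : Finset ι → Prop}

lemma CoveredBy.mono (h : CoveredBy T N Q) (hN : N ≤ M)
    (hQ : ∀ S ⊆ T, S.Nonempty → Q S → R S) : CoveredBy T M R := by
  obtain ⟨C, hC, hT, hS⟩ := h
  exact ⟨C, hC.trans hN, hT, fun S h => ⟨(hS S h).1, (hS S h).2.1,
    hQ S (hS S h).1 (hS S h).2.1 (hS S h).2.2⟩⟩

/-- Cardinalities multiply. The parent `S` is recorded so that properties inherited by subfamilies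
remain available after several refinements. -/
lemma CoveredBy.refine (h : CoveredBy T N Q) (hM : 0 ≤ M)
    (hR : ∀ S ⊆ T, S.Nonempty → Q S → CoveredBy S M R) :
    CoveredBy T (N * M) (fun U => R U ∧ ∃ S ⊆ T, Q S ∧ U ⊆ S) := by
  classical
  obtain ⟨C, hC, hT, hS⟩ := h
  choose! D hD using fun S (hSC : S ∈ C) => hR S (hS S hSC).1 (hS S hSC).2.1 (hS S hSC).2.2
  refine ⟨C.biUnion D, ?_, ?_, ?_⟩
  · calc ((C.biUnion D).card : ℝ) ≤ ∑ S ∈ C, ((D S).card : ℝ) := by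
          exact_mod_cast Finset.card_biUnion_le
      _ ≤ ∑ S ∈ C, M := Finset.sum_le_sum fun S h => (hD S h).1
      _ = C.card * M := by simp
      _ ≤ N * M := mul_le_mul_of_nonneg_right hC hM
  · intro i hi
    obtain ⟨S, hSC, hiS⟩ := hT i hi
    obtain ⟨U, hU, hiU⟩ := (hD S hSC).2.1 i hiS
    exact ⟨U, Finset.mem_biUnion.2 ⟨S, hSC, hU⟩, hiU⟩
  · intro U hU
    obtain ⟨S, hSC, hU⟩ := Finset.mem_biUnion.1 hU
    obtain ⟨h1, h2, h3⟩ := (hD S hSC).2.2 U hU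
    exact ⟨h1.trans (hS S hSC).1, h2, h3, S, (hS S hSC).1, (hS S hSC).2.2, h1⟩

/-- Packing argument: sets of measure at least `m` have few pairwise disjoint members. -/
lemma coveredBy_of_measure_ge {V : Type*} [MeasurableSpace V] (μ : Measure V)
    [IsProbabilityMeasure μ] (T : Finset ι) (G : ι → Set V) (hG : ∀ i ∈ T, MeasurableSet (G i))
    {m : ℝ} (hm : 0 < m) (hμ : ∀ i ∈ T, ENNReal.ofReal m ≤ μ (G i)) :
    CoveredBy T m⁻¹ (fun S => ∃ i ∈ S, ∀ j ∈ S, (G i ∩ G j).Nonempty) := by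
  classical
  have hne : ∀ i ∈ T, (G i).Nonempty := by
    intro i hi
    by_contra h
    rw [Set.not_nonempty_iff_eq_empty] at h
    have := hμ i hi
    rw [h, measure_empty] at this
    simp only [nonpos_iff_eq_zero, ENNReal.ofReal_eq_zero] at this
    linarith
  -- A pairwise disjoint subfamily of maximal cardinality has at most `m⁻¹` members, and by
  -- maximality every `G j` meets one of them. The pieces are the resulting neighbourhoods, which
  -- may overlap.
  let D : Finset (Finset ι) := T.powerset.filter fun U => (U : Set ι).PairwiseDisjoint G
  have hD : D.Nonempty := ⟨∅, by simp [D]⟩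
  obtain ⟨U, hU, hmax⟩ := Finset.exists_max_image D Finset.card hD
  simp only [D, Finset.mem_filter, Finset.mem_powerset] at hU
  have hcard : (U.card : ℝ) ≤ m⁻¹ := by
    have h1 : ∑ i ∈ U, μ (G i) ≤ 1 := by
      rw [← measure_biUnion_finset hU.2 fun i hi => hG i (hU.1 hi)]
      exact prob_le_one
    have h2 : (U.card : ENNReal) * ENNReal.ofReal m ≤ 1 := by
      refine le_trans ?_ h1
      rw [← nsmul_eq_mul]
      exact Finset.card_nsmul_le_sum _ _ _ fun i hi => hμ i (hU.1 hi)
    have h3 : (U.card : ℝ) * m ≤ 1 := by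
      have := ENNReal.toReal_mono (by simp) h2
      simpa [ENNReal.toReal_ofReal hm.le] using this
    rwa [← one_div, le_div_iff₀ hm]
  refine ⟨U.image fun i => T.filter fun j => (G i ∩ G j).Nonempty, ?_, ?_, ?_⟩
  · exact le_trans (by exact_mod_cast Finset.card_image_le) hcard
  · intro j hj
    by_cases hex : ∃ i ∈ U, (G i ∩ G j).Nonempty
    · obtain ⟨i, hi, hij⟩ := hex
      exact ⟨_, Finset.mem_image_of_mem _ hi, by simp [hj, hij]⟩
    · exfalso
      push Not at hex
      have hjU : j ∉ U := fun h => by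
        have := hex j h
        rw [Set.inter_self] at this
        exact (hne j hj).ne_empty this
      have : insert j U ∈ D := by
        simp only [D, Finset.mem_filter, Finset.mem_powerset]
        refine ⟨Finset.insert_subset hj hU.1, ?_⟩
        rw [Finset.coe_insert]
        refine hU.2.insert fun i hi _ => ?_
        exact (Set.disjoint_iff_inter_eq_empty.2 (hex i hi)).symm
      have := hmax _ this
      rw [Finset.card_insert_of_notMem hjU] at this
      omega
  · intro S hS
    obtain ⟨i, hi, rfl⟩ := Finset.mem_image.1 hS
    have hii : i ∈ T.filter fun j => (G i ∩ G j).Nonempty := by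
      simp [hU.1 hi, hne i (hU.1 hi)]
    exact ⟨Finset.filter_subset _ _, ⟨i, hii⟩, i, hii, fun j hj => (Finset.mem_filter.1 hj).2⟩

end Covers

/-! ### Products of the hyperbolic secant law -/

/-- An even density whose translates satisfy a midpoint log-concavity lower bound gives
symmetric sets translates of comparable measure. -/
lemma withDensity_translate_ge {V : Type*} [AddCommGroup V] [MeasurableSpace V]
    [MeasurableAdd V] [MeasurableNeg V] (lam : Measure V) [lam.IsAddLeftInvariant]
    (hneg : MeasurePreserving (Neg.neg : V → V) lam lam)
    (f : V → ℝ) (hf : Measurable f) (hf0 : ∀ y, 0 ≤ f y) (heven : ∀ y, f (-y) = f y)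
    (x : V) (κ : ℝ) (hx : ∀ y, Real.exp (-(2 * κ)) * f y ^ 2 ≤ f (y + x) * f (y - x))
    (K : Set V) (hK : MeasurableSet K) (hsymm : ∀ y ∈ K, -y ∈ K) :
    ENNReal.ofReal (Real.exp (-κ)) * (lam.withDensity fun y => ENNReal.ofReal (f y)) K ≤
      (lam.withDensity fun y => ENNReal.ofReal (f y)) {z | z - x ∈ K} := by
  set g : V → ENNReal := fun y => ENNReal.ofReal (f y) with hg
  have hgm : Measurable g := by fun_prop
  have hshift : MeasurableSet {z | z - x ∈ K} := by
    simp only [sub_eq_add_neg]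
    exact measurable_add_const (-x) hK
  rw [withDensity_apply _ hK, withDensity_apply _ hshift]
  have e1 : ∫⁻ z in {z | z - x ∈ K}, g z ∂lam = ∫⁻ y in K, g (y + x) ∂lam := by
    rw [← lintegral_indicator hshift, ← lintegral_indicator hK,
      ← lintegral_add_right_eq_self _ x]
    refine lintegral_congr fun y => ?_
    have h1 : y + x ∈ {z | z - x ∈ K} ↔ y ∈ K := by simp
    by_cases h : y ∈ K
    · rw [Set.indicator_of_mem (h1.2 h), Set.indicator_of_mem h]
    · rw [Set.indicator_of_notMem (fun h' => h (h1.1 h')), Set.indicator_of_notMem h]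
  have e2 : ∫⁻ y in K, g (y + x) ∂lam = ∫⁻ y in K, g (y - x) ∂lam := by
    rw [← lintegral_indicator hK, ← lintegral_indicator hK]
    have hm : Measurable (K.indicator fun y => g (y + x)) :=
      (hgm.comp (measurable_add_const x)).indicator hK
    rw [← hneg.lintegral_comp hm]
    refine lintegral_congr fun y => ?_
    have h1 : g (-y + x) = g (y - x) := by
      simp only [hg]
      rw [← heven (y - x)]
      congr 2
      abel
    by_cases h : y ∈ K
    · simp [h, hsymm y h, h1]
    · have : -y ∉ K := fun h' => h (by simpa using hsymm _ h')
      simp [h, this]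
  -- By symmetry the shifts by `x` and `-x` give the same integral, so their pointwise sum may be
  -- used; by AM–GM and `hx` it is at least `2 * exp (-κ) * f y`.
  have e3 : 2 * (ENNReal.ofReal (Real.exp (-κ)) * ∫⁻ y in K, g y ∂lam) ≤
      (∫⁻ y in K, g (y + x) ∂lam) + ∫⁻ y in K, g (y - x) ∂lam := by
    rw [← lintegral_const_mul _ hgm, ← lintegral_const_mul _ (by fun_prop),
      ← lintegral_add_left (show Measurable fun y => g (y + x) from
        hgm.comp (measurable_add_const x))]
    refine lintegral_mono fun y => ?_
    simp only [hg]
    rw [← ENNReal.ofReal_mul (Real.exp_pos _).le, ← ENNReal.ofReal_add (hf0 _) (hf0 _),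
      show (2 : ENNReal) = ENNReal.ofReal 2 by simp, ← ENNReal.ofReal_mul (by norm_num)]
    refine ENNReal.ofReal_le_ofReal ?_
    have h1 : (Real.exp (-κ) * f y) ^ 2 ≤ f (y + x) * f (y - x) := by
      refine le_trans (le_of_eq ?_) (hx y)
      rw [mul_pow, ← Real.exp_nat_mul]
      congr 2
      push_cast
      ring
    refine abs_le_of_sq_le_sq' ?_ (add_nonneg (hf0 _) (hf0 _)) |>.2
    nlinarith [sq_nonneg (f (y + x) - f (y - x))]
  rw [e1]
  rw [← e2, ← two_mul] at e3
  exact (ENNReal.mul_le_mul_iff_right (by simp) (by simp)).1 e3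

/-- The quartic term of the exponential series gives x⁴ ≤ 48 cosh x, and (1+x²)² ≤ 2 + 2x⁴. This
dominates both 1/cosh and x²/cosh by a multiple of 1/(1+x²). -/
lemma sq_one_add_sq_le_cosh (x : ℝ) : (1 + x ^ 2) ^ 2 ≤ 98 * Real.cosh x := by
  have h1 : |x| ^ 4 / 24 ≤ Real.exp |x| := by
    simpa [Nat.factorial] using Real.pow_div_factorial_le_exp |x| (abs_nonneg x) 4
  have h2 : Real.exp |x| ≤ 2 * Real.cosh x := by
    rw [← Real.cosh_abs, Real.cosh_eq]
    linarith [Real.exp_pos (-|x|)]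
  have h3 := Real.one_le_cosh x
  have h4 : |x| ^ 4 = x ^ 4 := by
    rw [show (4 : ℕ) = 2 * 2 by norm_num, pow_mul, pow_mul, sq_abs]
  rw [h4] at h1
  nlinarith [sq_nonneg (1 - x ^ 2)]

lemma integrable_sq_mul_inv_cosh : Integrable fun x : ℝ => x ^ 2 * (Real.cosh x)⁻¹ := by
  refine (integrable_inv_one_add_sq.const_mul 98).mono' ?_ ?_
  · exact (((continuous_id.pow 2).mul (Real.continuous_cosh.inv₀ fun x =>
      (Real.cosh_pos x).ne'))).aestronglyMeasurable
  · refine Filter.Eventually.of_forall fun x => ?_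
    have hc := Real.cosh_pos x
    rw [Real.norm_of_nonneg (by positivity), ← div_eq_mul_inv, ← div_eq_mul_inv,
      div_le_div_iff₀ hc (by positivity)]
    nlinarith [sq_one_add_sq_le_cosh x, sq_nonneg x]

lemma integrable_inv_cosh : Integrable fun x : ℝ => (Real.cosh x)⁻¹ := by
  refine (integrable_inv_one_add_sq.const_mul 98).mono' ?_ ?_
  · exact (Real.continuous_cosh.inv₀ fun x => (Real.cosh_pos x).ne').aestronglyMeasurable
  · refine Filter.Eventually.of_forall fun x => ?_
    have hc := Real.cosh_pos x
    rw [Real.norm_of_nonneg (by positivity), ← one_div, ← div_eq_mul_inv,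
      div_le_div_iff₀ hc (by positivity)]
    nlinarith [sq_one_add_sq_le_cosh x, sq_nonneg x]

lemma integral_inv_cosh_pos : 0 < ∫ x : ℝ, (Real.cosh x)⁻¹ := by
  refine (integral_pos_iff_support_of_nonneg (fun x => (inv_pos.2 (Real.cosh_pos x)).le)
    integrable_inv_cosh).2 ?_
  have : (Function.support fun x : ℝ => (Real.cosh x)⁻¹) = Set.univ := by
    ext x
    simp [(Real.cosh_pos x).ne']
  rw [this]
  simp

/-- The density proportional to `1 / cosh`. -/
def sechDensity (x : ℝ) : ℝ := (∫ x : ℝ, (Real.cosh x)⁻¹)⁻¹ * (Real.cosh x)⁻¹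

lemma sechDensity_pos (x : ℝ) : 0 < sechDensity x :=
  mul_pos (inv_pos.2 integral_inv_cosh_pos) (inv_pos.2 (Real.cosh_pos x))

lemma sechDensity_neg (x : ℝ) : sechDensity (-x) = sechDensity x := by
  simp [sechDensity]

lemma continuous_sechDensity : Continuous sechDensity :=
  continuous_const.mul (Real.continuous_cosh.inv₀ fun x => (Real.cosh_pos x).ne')

lemma integrable_sechDensity : Integrable sechDensity := integrable_inv_cosh.const_mul _

lemma integral_sechDensity : ∫ x, sechDensity x = 1 := by
  simp only [sechDensity]
  rw [integral_const_mul, inv_mul_cancel₀ integral_inv_cosh_pos.ne']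

/-- Because cosh(y+x)cosh(y-x) = cosh²y cosh²x - sinh²y sinh²x. -/
lemma sechDensity_mul_ge (y x : ℝ) :
    (Real.cosh x ^ 2)⁻¹ * sechDensity y ^ 2 ≤ sechDensity (y + x) * sechDensity (y - x) := by
  have h : Real.cosh (y + x) * Real.cosh (y - x) ≤ Real.cosh y ^ 2 * Real.cosh x ^ 2 := by
    rw [Real.cosh_add, Real.cosh_sub]
    nlinarith [mul_nonneg (sq_nonneg (Real.sinh y)) (sq_nonneg (Real.sinh x))]
  have h1 := Real.cosh_pos (y + x)
  have h2 := Real.cosh_pos (y - x)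
  have h3 : (Real.cosh y ^ 2 * Real.cosh x ^ 2)⁻¹ ≤ (Real.cosh (y + x) * Real.cosh (y - x))⁻¹ :=
    inv_anti₀ (by positivity) h
  have hZ := integral_inv_cosh_pos
  simp only [sechDensity]
  calc _ = ((∫ x : ℝ, (Real.cosh x)⁻¹)⁻¹) ^ 2 * (Real.cosh y ^ 2 * Real.cosh x ^ 2)⁻¹ := by
        rw [mul_inv]; ring
    _ ≤ ((∫ x : ℝ, (Real.cosh x)⁻¹)⁻¹) ^ 2 * (Real.cosh (y + x) * Real.cosh (y - x))⁻¹ := by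
        gcongr
    _ = _ := by rw [mul_inv]; ring

/-- The hyperbolic secant law. -/
def sechLaw : Measure ℝ := volume.withDensity fun x => ENNReal.ofReal (sechDensity x)

lemma sechLaw_apply {s : Set ℝ} (hs : MeasurableSet s) :
    sechLaw s = ENNReal.ofReal (∫ x in s, sechDensity x) := by
  rw [sechLaw, withDensity_apply _ hs, ofReal_integral_eq_lintegral_ofReal
    integrable_sechDensity.integrableOn
    (Filter.Eventually.of_forall fun x => (sechDensity_pos x).le)]

instance isProbabilityMeasure_sechLaw : IsProbabilityMeasure sechLaw :=
  ⟨by rw [sechLaw_apply MeasurableSet.univ, setIntegral_univ, integral_sechDensity]; simp⟩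

lemma integral_sechLaw (f : ℝ → ℝ) : ∫ x, f x ∂sechLaw = ∫ x, sechDensity x * f x := by
  rw [sechLaw, integral_withDensity_eq_integral_toReal_smul
    continuous_sechDensity.measurable.ennreal_ofReal (by simp)]
  refine integral_congr_ae (Filter.Eventually.of_forall fun x => ?_)
  simp [(sechDensity_pos x).le]

lemma integral_id_sechLaw : ∫ x, x ∂sechLaw = 0 := by
  rw [integral_sechLaw]
  have h := integral_neg_eq_self (fun x : ℝ => sechDensity x * x) volume
  simp only [sechDensity_neg, mul_neg] at h
  rw [integral_neg] at h
  linarith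

lemma memLp_id_sechLaw : MemLp (fun x => x) 2 sechLaw := by
  refine (memLp_two_iff_integrable_sq measurable_id.aestronglyMeasurable).2 ?_
  rw [sechLaw, integrable_withDensity_iff_integrable_smul'
    continuous_sechDensity.measurable.ennreal_ofReal (by simp)]
  refine (integrable_sq_mul_inv_cosh.const_mul ((∫ x : ℝ, (Real.cosh x)⁻¹)⁻¹)).congr ?_
  refine Filter.Eventually.of_forall fun x => ?_
  simp only [ENNReal.toReal_ofReal (sechDensity_pos x).le, smul_eq_mul]
  simp only [sechDensity, id]
  ring

/-- The variance of the hyperbolic secant law. -/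
def sechVar : ℝ := ∫ x, x ^ 2 ∂sechLaw

lemma sechVar_nonneg : 0 ≤ sechVar := integral_nonneg fun x => sq_nonneg x

/-- The product of copies of the hyperbolic secant law. -/
def sechPi (ι : Type*) [Fintype ι] : Measure (ι → ℝ) := Measure.pi fun _ => sechLaw

section SechPi

variable {ι : Type*} [Fintype ι]

instance isProbabilityMeasure_sechPi : IsProbabilityMeasure (sechPi ι) := by
  unfold sechPi; infer_instance

lemma sechPi_eq_withDensity :
    sechPi ι = volume.withDensity fun y => ENNReal.ofReal (∏ i, sechDensity (y i)) := by
  refine Measure.pi_eq fun s hs => ?_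
  rw [withDensity_apply _ (MeasurableSet.univ_pi hs), volume_pi, Measure.restrict_pi_pi,
    ← ofReal_integral_eq_lintegral_ofReal]
  · rw [integral_fintype_prod_eq_prod (fun _ => sechDensity),
      ENNReal.ofReal_prod_of_nonneg fun i _ =>
        setIntegral_nonneg (hs i) fun x _ => (sechDensity_pos x).le]
    exact Finset.prod_congr rfl fun i _ => (sechLaw_apply (hs i)).symm
  · exact Integrable.fintype_prod fun i => integrable_sechDensity.integrableOn
  · exact Filter.Eventually.of_forall fun y => Finset.prod_nonneg fun i _ => (sechDensity_pos _).le

lemma prod_sechDensity_mul_ge (y x : ι → ℝ) {κ : ℝ} (hx : ∏ i, Real.cosh (x i) ≤ Real.exp κ) :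
    Real.exp (-(2 * κ)) * (∏ i, sechDensity (y i)) ^ 2 ≤
      (∏ i, sechDensity ((y + x) i)) * ∏ i, sechDensity ((y - x) i) := by
  have hpos : 0 < ∏ i, Real.cosh (x i) := Finset.prod_pos fun i _ => Real.cosh_pos _
  have h1 : Real.exp (-(2 * κ)) ≤ ((∏ i, Real.cosh (x i)) ^ 2)⁻¹ := by
    rw [Real.exp_neg]
    refine inv_anti₀ (by positivity) ?_
    calc (∏ i, Real.cosh (x i)) ^ 2 ≤ Real.exp κ ^ 2 := by gcongr
      _ = Real.exp (2 * κ) := by rw [← Real.exp_nat_mul]; norm_num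
  calc _ ≤ ((∏ i, Real.cosh (x i)) ^ 2)⁻¹ * (∏ i, sechDensity (y i)) ^ 2 := by gcongr
    _ = ∏ i, ((Real.cosh (x i) ^ 2)⁻¹ * sechDensity (y i) ^ 2) := by
        rw [Finset.prod_mul_distrib, Finset.prod_inv_distrib, Finset.prod_pow, Finset.prod_pow]
    _ ≤ ∏ i, (sechDensity (y i + x i) * sechDensity (y i - x i)) :=
        Finset.prod_le_prod (fun i _ => by positivity) fun i _ => sechDensity_mul_ge _ _
    _ = _ := by rw [Finset.prod_mul_distrib]; rfl

lemma measurePreserving_neg_volume_pi :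
    MeasurePreserving (Neg.neg : (ι → ℝ) → (ι → ℝ)) volume volume :=
  Measure.measurePreserving_neg _

lemma continuous_prod_sechDensity :
    Continuous fun y : ι → ℝ => ∏ i, sechDensity (y i) :=
  continuous_finsetProd _ fun i _ => continuous_sechDensity.comp (continuous_apply i)

lemma sechPi_translate_ge (x : ι → ℝ) {κ : ℝ} (hx : ∏ i, Real.cosh (x i) ≤ Real.exp κ)
    (K : Set (ι → ℝ)) (hK : MeasurableSet K) (hsymm : ∀ y ∈ K, -y ∈ K) :
    ENNReal.ofReal (Real.exp (-κ)) * sechPi ι K ≤ sechPi ι {z | z - x ∈ K} := by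
  rw [sechPi_eq_withDensity]
  refine withDensity_translate_ge _ measurePreserving_neg_volume_pi _
    continuous_prod_sechDensity.measurable
    (fun y => Finset.prod_nonneg fun i _ => (sechDensity_pos _).le)
    (fun y => by simp [sechDensity_neg]) x κ (fun y => prod_sechDensity_mul_ge y x hx) K hK hsymm

lemma sechPi_prod_translate_ge (x y : ι → ℝ) {κ κ' : ℝ}
    (hx : ∏ i, Real.cosh (x i) ≤ Real.exp κ) (hy : ∏ i, Real.cosh (y i) ≤ Real.exp κ')
    (K : Set ((ι → ℝ) × (ι → ℝ))) (hK : MeasurableSet K) (hsymm : ∀ y ∈ K, -y ∈ K) :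
    ENNReal.ofReal (Real.exp (-(κ + κ'))) * ((sechPi ι).prod (sechPi ι)) K ≤
      ((sechPi ι).prod (sechPi ι)) {z | z - (x, y) ∈ K} := by
  have hm := (continuous_prod_sechDensity (ι := ι)).measurable
  have hnn : ∀ y : ι → ℝ, 0 ≤ ∏ i, sechDensity (y i) :=
    fun y => Finset.prod_nonneg fun i _ => (sechDensity_pos _).le
  have hν : (sechPi ι).prod (sechPi ι) = (volume.prod volume).withDensity
      fun q : (ι → ℝ) × (ι → ℝ) =>
        ENNReal.ofReal ((∏ i, sechDensity (q.1 i)) * ∏ i, sechDensity (q.2 i)) := by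
    rw [sechPi_eq_withDensity, prod_withDensity hm.ennreal_ofReal hm.ennreal_ofReal]
    congr 1
    ext q
    rw [ENNReal.ofReal_mul (hnn _)]
  rw [hν]
  refine withDensity_translate_ge _
    (measurePreserving_neg_volume_pi.prod measurePreserving_neg_volume_pi) _
    (show Measurable fun q : (ι → ℝ) × (ι → ℝ) =>
      (∏ i, sechDensity (q.1 i)) * ∏ i, sechDensity (q.2 i) from
        (hm.comp measurable_fst).mul (hm.comp measurable_snd))
    (fun q => mul_nonneg (hnn _) (hnn _))
    (fun q => by simp [sechDensity_neg]) (x, y) (κ + κ') (fun q => ?_) K hK hsymm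
  calc _ = (Real.exp (-(2 * κ)) * (∏ i, sechDensity (q.1 i)) ^ 2) *
        (Real.exp (-(2 * κ')) * (∏ i, sechDensity (q.2 i)) ^ 2) := by
          rw [show -(2 * (κ + κ')) = -(2 * κ) + -(2 * κ') by ring, Real.exp_add]; ring
    _ ≤ ((∏ i, sechDensity ((q.1 + x) i)) * ∏ i, sechDensity ((q.1 - x) i)) *
        ((∏ i, sechDensity ((q.2 + y) i)) * ∏ i, sechDensity ((q.2 - y) i)) :=
          mul_le_mul (prod_sechDensity_mul_ge _ _ hx) (prod_sechDensity_mul_ge _ _ hy)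
            (by positivity) (mul_nonneg (hnn _) (hnn _))
    _ = _ := by
        rw [show (q + (x, y)).1 = q.1 + x from rfl, show (q + (x, y)).2 = q.2 + y from rfl,
          show (q - (x, y)).1 = q.1 - x from rfl, show (q - (x, y)).2 = q.2 - y from rfl]
        ring

/-- The square of the Hilbert–Schmidt norm of a linear map on `ι → ℝ`. -/
def hsSq {F : Type*} [NormedAddCommGroup F] [InnerProductSpace ℝ F] [DecidableEq ι]
    (H : (ι → ℝ) →ₗ[ℝ] F) : ℝ := ∑ i, ‖H (Pi.single i 1)‖ ^ 2

variable {F : Type*} [NormedAddCommGroup F] [InnerProductSpace ℝ F] [DecidableEq ι]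

omit [DecidableEq ι] in
lemma integrable_mul_sechPi (a b : ι) : Integrable (fun z : ι → ℝ => z a * z b) (sechPi ι) := by
  have h : ∀ a : ι, MemLp (fun z : ι → ℝ => z a) 2 (sechPi ι) := fun a =>
    memLp_id_sechLaw.comp_measurePreserving (measurePreserving_eval (fun _ => sechLaw) a)
  exact (h a).integrable_mul (h b)

/-- Coordinates are independent and centred, hence orthogonal in L²; this is what turns second
moments of linear images into Hilbert–Schmidt norms. -/
lemma integral_mul_sechPi (a b : ι) :
    ∫ z, z a * z b ∂sechPi ι = if a = b then sechVar else 0 := by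
  split_ifs with h
  · subst h
    rw [sechVar, ← integral_comp_eval (μ := fun _ : ι => sechLaw) (i := a)
      (f := fun x : ℝ => x ^ 2) (by fun_prop)]
    simp only [sq, sechPi]
  · have hind := (iIndepFun_pi (μ := fun _ : ι => sechLaw) (X := fun _ x => x)
      fun _ => aemeasurable_id).indepFun h
    have h0 : ∫ z : ι → ℝ, z a ∂sechPi ι = 0 := by
      have := integral_comp_eval (μ := fun _ : ι => sechLaw) (i := a)
        (f := fun x : ℝ => x) (by fun_prop)
      rw [sechPi, this, integral_id_sechLaw]
    have h1 := hind.integral_fun_mul_eq_mul_integral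
      (measurable_pi_apply a).aestronglyMeasurable (measurable_pi_apply b).aestronglyMeasurable
    change ∫ z : ι → ℝ, z a * z b ∂Measure.pi _ = 0
    rw [h1]
    rw [sechPi] at h0
    rw [h0, zero_mul]

lemma norm_sq_eq_sum (H : (ι → ℝ) →ₗ[ℝ] F) (z : ι → ℝ) :
    ‖H z‖ ^ 2 = ∑ a, ∑ b, z a * z b * inner ℝ (H (Pi.single a 1)) (H (Pi.single b 1)) := by
  have h : H z = ∑ a, z a • H (Pi.single a 1) := by
    rw [LinearMap.pi_apply_eq_sum_univ H z]
    congr 1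
    ext i
    congr 2
    ext j
    simp [Pi.single_apply, eq_comm]
  rw [← real_inner_self_eq_norm_sq, h, sum_inner]
  refine Finset.sum_congr rfl fun a _ => ?_
  rw [inner_sum]
  refine Finset.sum_congr rfl fun b _ => ?_
  rw [real_inner_smul_left, real_inner_smul_right, mul_assoc]

lemma lintegral_norm_sq_sechPi (H : (ι → ℝ) →ₗ[ℝ] F) :
    ∫⁻ z, ENNReal.ofReal (‖H z‖ ^ 2) ∂sechPi ι = ENNReal.ofReal (sechVar * hsSq H) := by
  have hi : ∀ a b, Integrable (fun z : ι → ℝ => z a * z b *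
      inner ℝ (H (Pi.single a 1)) (H (Pi.single b 1))) (sechPi ι) :=
    fun a b => (integrable_mul_sechPi a b).mul_const _
  have hint : Integrable (fun z => ‖H z‖ ^ 2) (sechPi ι) := by
    simp_rw [norm_sq_eq_sum]
    exact integrable_finsetSum _ fun a _ => integrable_finsetSum _ fun b _ => hi a b
  rw [← ofReal_integral_eq_lintegral_ofReal hint
    (Filter.Eventually.of_forall fun z => by positivity)]
  congr 1
  simp_rw [norm_sq_eq_sum]
  rw [integral_finsetSum _ fun a _ => integrable_finsetSum _ fun b _ => hi a b, hsSq,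
    Finset.mul_sum]
  refine Finset.sum_congr rfl fun a _ => ?_
  rw [integral_finsetSum _ fun b _ => hi a b]
  simp_rw [integral_mul_const, integral_mul_sechPi]
  simp

omit [DecidableEq ι] in
lemma continuous_linearMap_pi (H : (ι → ℝ) →ₗ[ℝ] F) : Continuous H :=
  H.continuous_of_finiteDimensional

/-- The scale at which Chebyshev's inequality is applied to the hyperbolic secant law. -/
def sechTau : ℝ := 4 * √sechVar + 1

lemma sechTau_pos : 0 < sechTau := by unfold sechTau; positivity

lemma sechVar_le_sechTau : 16 * sechVar ≤ sechTau ^ 2 := by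
  have := Real.sq_sqrt sechVar_nonneg
  have h := Real.sqrt_nonneg sechVar
  unfold sechTau
  nlinarith

end SechPi

/-! ### Coverings for linear and bilinear images -/

section Covering

variable {ι : Type*} [Fintype ι] [DecidableEq ι]
  {F : Type*} [NormedAddCommGroup F] [InnerProductSpace ℝ F]

lemma hsSq_nonneg (H : (ι → ℝ) →ₗ[ℝ] F) : 0 ≤ hsSq H :=
  Finset.sum_nonneg fun _ _ => sq_nonneg _

/-- Chebyshev's inequality in a form that applies to linear and to bilinear images. -/
lemma measure_norm_gt_le {F : Type*} [NormedAddCommGroup F] {Ω : Type*} [MeasurableSpace Ω] (μ : Measure Ω)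
    (f : Ω → F) (hf : Measurable fun ω => ‖f ω‖) {s r : ℝ} (hr : 0 < r)
    (hs : ∫⁻ ω, ENNReal.ofReal (‖f ω‖ ^ 2) ∂μ ≤ ENNReal.ofReal s) (hsr : 16 * s ≤ r ^ 2) :
    μ {ω | r < ‖f ω‖} ≤ ENNReal.ofReal (1 / 16) := by
  have h1 := mul_meas_ge_le_lintegral (μ := μ) (hf.pow_const 2).ennreal_ofReal
    (ENNReal.ofReal (r ^ 2))
  have hsub : {ω | r < ‖f ω‖} ⊆ {ω | ENNReal.ofReal (r ^ 2) ≤ ENNReal.ofReal (‖f ω‖ ^ 2)} := by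
    intro ω (hω : r < ‖f ω‖)
    exact ENNReal.ofReal_le_ofReal (by gcongr)
  have h2 : ENNReal.ofReal (r ^ 2) * μ {ω | r < ‖f ω‖} ≤ ENNReal.ofReal s :=
    le_trans (by gcongr) (h1.trans hs)
  have h3 : ENNReal.ofReal s ≤ ENNReal.ofReal (r ^ 2) * ENNReal.ofReal (1 / 16) := by
    rw [← ENNReal.ofReal_mul (by positivity)]
    exact ENNReal.ofReal_le_ofReal (by linarith)
  exact (ENNReal.mul_le_mul_iff_right (by simpa using by positivity) (by simp)).1 (h2.trans h3)

lemma sechPi_norm_gt_le (H : (ι → ℝ) →ₗ[ℝ] F) {h : ℝ} (h0 : 0 < h) (hH : hsSq H ≤ h ^ 2) :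
    sechPi ι {z | sechTau * h < ‖H z‖} ≤ ENNReal.ofReal (1 / 16) := by
  refine measure_norm_gt_le _ _ (continuous_linearMap_pi H).norm.measurable
    (mul_pos sechTau_pos h0) (lintegral_norm_sq_sechPi H).le ?_
  rw [mul_pow, ← mul_assoc]
  exact mul_le_mul sechVar_le_sechTau hH (hsSq_nonneg H) (sq_nonneg _)

/-- The family of all `A x eⱼ`, as a vector whose norm is the Hilbert–Schmidt norm of `A x`. -/
def hsMap (A : (ι → ℝ) →ₗ[ℝ] (ι → ℝ) →ₗ[ℝ] F) : (ι → ℝ) →ₗ[ℝ] PiLp 2 (fun _ : ι => F) where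
  toFun x := WithLp.toLp 2 fun j => A x (Pi.single j 1)
  map_add' x y := by ext j; simp
  map_smul' c x := by ext j; simp

lemma norm_hsMap_sq (A : (ι → ℝ) →ₗ[ℝ] (ι → ℝ) →ₗ[ℝ] F) (x : ι → ℝ) :
    ‖hsMap A x‖ ^ 2 = hsSq (A x) := by
  rw [PiLp.norm_sq_eq_of_L2]
  rfl

lemma hsSq_hsMap_flip (A : (ι → ℝ) →ₗ[ℝ] (ι → ℝ) →ₗ[ℝ] F) :
    hsSq (hsMap A.flip) = hsSq (hsMap A) := by
  simp only [hsSq, PiLp.norm_sq_eq_of_L2]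
  exact Finset.sum_comm

lemma continuous_bilin_pi (A : (ι → ℝ) →ₗ[ℝ] (ι → ℝ) →ₗ[ℝ] F) :
    Continuous fun q : (ι → ℝ) × (ι → ℝ) => A q.1 q.2 := by
  have h : ∀ q : (ι → ℝ) × (ι → ℝ), A q.1 q.2 = ∑ j, q.2 j • A.flip (Pi.single j 1) q.1 := by
    intro q
    conv_lhs => rw [LinearMap.pi_apply_eq_sum_univ (A q.1) q.2]
    refine Finset.sum_congr rfl fun j _ => ?_
    rw [LinearMap.flip_apply]
    congr 2
    ext k
    simp [Pi.single_apply, eq_comm]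
  simp_rw [h]
  refine continuous_finsetSum _ fun j _ => ?_
  exact ((continuous_apply j).comp continuous_snd).smul
    ((continuous_linearMap_pi _).comp continuous_fst)

/-- Integrating first in the second variable leaves `sechVar * ‖hsMap A x‖ ^ 2`, again the squared
norm of a linear image. The second moment is therefore the squared variance times `hsSq (hsMap A)`,
which explains `sechTau ^ 2`. -/
lemma sechPi_prod_norm_gt_le (A : (ι → ℝ) →ₗ[ℝ] (ι → ℝ) →ₗ[ℝ] F) {a : ℝ} (a0 : 0 < a)
    (hA : hsSq (hsMap A) ≤ a ^ 2) :
    ((sechPi ι).prod (sechPi ι)) {q | sechTau ^ 2 * a < ‖A q.1 q.2‖} ≤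
      ENNReal.ofReal (1 / 16) := by
  have hc := (continuous_bilin_pi A).norm
  refine measure_norm_gt_le _ (fun q : (ι → ℝ) × (ι → ℝ) => A q.1 q.2) hc.measurable
    (mul_pos (pow_pos sechTau_pos 2) a0) (s := sechVar * (sechVar * a ^ 2)) ?_ ?_
  · rw [lintegral_prod (fun q : (ι → ℝ) × (ι → ℝ) => ENNReal.ofReal (‖A q.1 q.2‖ ^ 2))
      (hc.pow 2).measurable.ennreal_ofReal.aemeasurable]
    simp_rw [lintegral_norm_sq_sechPi]
    calc ∫⁻ x, ENNReal.ofReal (sechVar * hsSq (A x)) ∂sechPi ι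
        = ENNReal.ofReal sechVar * ∫⁻ x, ENNReal.ofReal (‖hsMap A x‖ ^ 2) ∂sechPi ι := by
          have hm : Measurable fun x => ENNReal.ofReal (‖hsMap A x‖ ^ 2) :=
            ((continuous_linearMap_pi (hsMap A)).norm.pow 2).measurable.ennreal_ofReal
          rw [← lintegral_const_mul _ hm]
          refine lintegral_congr fun x => ?_
          rw [norm_hsMap_sq, ENNReal.ofReal_mul sechVar_nonneg]
      _ = ENNReal.ofReal (sechVar * (sechVar * hsSq (hsMap A))) := by
          rw [lintegral_norm_sq_sechPi, ENNReal.ofReal_mul sechVar_nonneg,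
            ENNReal.ofReal_mul sechVar_nonneg, ENNReal.ofReal_mul sechVar_nonneg]
      _ ≤ _ := by
          have := sechVar_nonneg
          exact ENNReal.ofReal_le_ofReal (by gcongr)
  · have h1 := sechVar_le_sechTau
    have h2 := sechVar_nonneg
    have h3 : 16 * sechVar * (sechVar * a ^ 2) ≤ sechTau ^ 2 * (sechTau ^ 2 * a ^ 2) := by
      gcongr
      linarith
    calc _ = 16 * sechVar * (sechVar * a ^ 2) := by ring
      _ ≤ _ := h3
      _ = _ := by ring

lemma sechPi_prod_norm_fst_gt_le (H : (ι → ℝ) →ₗ[ℝ] F) {h : ℝ} (h0 : 0 < h)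
    (hH : hsSq H ≤ h ^ 2) :
    ((sechPi ι).prod (sechPi ι)) {q | sechTau * h < ‖H q.1‖} ≤ ENNReal.ofReal (1 / 16) := by
  have hm : MeasurableSet {z | sechTau * h < ‖H z‖} :=
    measurableSet_lt measurable_const (continuous_linearMap_pi H).norm.measurable
  exact ((measurePreserving_fst (μ := sechPi ι) (ν := sechPi ι)).measure_preimage
    hm.nullMeasurableSet).le.trans (sechPi_norm_gt_le H h0 hH)

lemma sechPi_prod_norm_snd_gt_le (H : (ι → ℝ) →ₗ[ℝ] F) {h : ℝ} (h0 : 0 < h)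
    (hH : hsSq H ≤ h ^ 2) :
    ((sechPi ι).prod (sechPi ι)) {q | sechTau * h < ‖H q.2‖} ≤ ENNReal.ofReal (1 / 16) := by
  have hm : MeasurableSet {z | sechTau * h < ‖H z‖} :=
    measurableSet_lt measurable_const (continuous_linearMap_pi H).norm.measurable
  exact ((measurePreserving_snd (μ := sechPi ι) (ν := sechPi ι)).measure_preimage
    hm.nullMeasurableSet).le.trans (sechPi_norm_gt_le H h0 hH)

lemma measure_union_five_le {Ω : Type*} [MeasurableSpace Ω] (μ : Measure Ω)
    {A B C D E : Set Ω} (hA : μ A ≤ ENNReal.ofReal (1 / 16)) (hB : μ B ≤ ENNReal.ofReal (1 / 16))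
    (hC : μ C ≤ ENNReal.ofReal (1 / 16)) (hD : μ D ≤ ENNReal.ofReal (1 / 16))
    (hE : μ E ≤ ENNReal.ofReal (1 / 16)) :
    μ ((A ∪ B) ∪ ((C ∪ D) ∪ E)) ≤ ENNReal.ofReal (1 / 2) := by
  have h1 := measure_union_le (μ := μ) (A ∪ B) ((C ∪ D) ∪ E)
  have h2 := (measure_union_le (μ := μ) A B).trans (add_le_add hA hB)
  have h3 := (measure_union_le (μ := μ) C D).trans (add_le_add hC hD)
  have h4 := (measure_union_le (μ := μ) (C ∪ D) E).trans (add_le_add h3 hE)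
  refine (h1.trans (add_le_add h2 h4)).trans ?_
  rw [← ENNReal.ofReal_add (by norm_num) (by norm_num),
    ← ENNReal.ofReal_add (by norm_num) (by norm_num),
    ← ENNReal.ofReal_add (by norm_num) (by norm_num)]
  exact ENNReal.ofReal_le_ofReal (by norm_num)

/-- A probability measure gives mass at least `1/2` to the complement of a set of mass `1/2`. -/
lemma half_le_measure_of_compl {Ω : Type*} [MeasurableSpace Ω] (μ : Measure Ω)
    [IsProbabilityMeasure μ] {K : Set Ω} (hK : MeasurableSet K)
    (h : μ Kᶜ ≤ ENNReal.ofReal (1 / 2)) : ENNReal.ofReal (1 / 2) ≤ μ K := by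
  have h1 := prob_add_prob_compl (μ := μ) hK
  have h2 : (1 : ENNReal) = ENNReal.ofReal (1 / 2) + ENNReal.ofReal (1 / 2) := by
    rw [← ENNReal.ofReal_add (by norm_num) (by norm_num)]; norm_num
  by_contra hlt
  push Not at hlt
  have h3 : μ K + μ Kᶜ < ENNReal.ofReal (1 / 2) + ENNReal.ofReal (1 / 2) :=
    ENNReal.add_lt_add_of_lt_of_le (by finiteness) hlt h
  rw [h1, ← h2] at h3
  exact lt_irrefl _ h3

variable {I : Type*}

/-- Pack the translates by `t⁻¹ • x i` of the symmetric set where ‖Hz‖ ≤ τh, with τ = `sechTau`. If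
two of them share a point z, then `x j - x i` is t times the difference of two elements of that set.
-/
lemma coveredBy_linear (T : Finset I) (x : I → ι → ℝ) {t κ h : ℝ} (ht : 0 < t)
    (hx : ∀ i ∈ T, ∏ k, Real.cosh (t⁻¹ * x i k) ≤ Real.exp κ)
    (H : (ι → ℝ) →ₗ[ℝ] F) (h0 : 0 < h) (hH : hsSq H ≤ h ^ 2) :
    CoveredBy T (2 * Real.exp κ)
      (fun S => ∃ i ∈ S, ∀ j ∈ S, ‖H (x j - x i)‖ ≤ 2 * sechTau * t * h) := by
  set K : Set (ι → ℝ) := {z | ‖H z‖ ≤ sechTau * h}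
  have hKm : MeasurableSet K := by
    exact measurableSet_le (continuous_linearMap_pi H).norm.measurable measurable_const
  have hKs : ∀ y ∈ K, -y ∈ K := by
    intro y (hy : ‖H y‖ ≤ _)
    change ‖H (-y)‖ ≤ _
    rwa [map_neg, norm_neg]
  have hKμ : ENNReal.ofReal (1 / 2) ≤ sechPi ι K := by
    refine half_le_measure_of_compl _ hKm ?_
    have : Kᶜ = {z | sechTau * h < ‖H z‖} := by
      ext z
      exact not_le (a := ‖H z‖)
    rw [this]
    exact (sechPi_norm_gt_le H h0 hH).trans (ENNReal.ofReal_le_ofReal (by norm_num))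
  have hm : (0 : ℝ) < Real.exp (-κ) * (1 / 2) := by positivity
  have key := coveredBy_of_measure_ge (sechPi ι) T
    (fun i => {z | z - t⁻¹ • x i ∈ K}) (fun i _ => hKm.preimage (measurable_sub_const _)) hm
    (fun i hi => by
      rw [ENNReal.ofReal_mul (Real.exp_pos _).le]
      refine le_trans (mul_le_mul_right hKμ _) ?_
      exact sechPi_translate_ge (t⁻¹ • x i) (hx i hi) K hKm hKs)
  refine key.mono (le_of_eq ?_) ?_
  · rw [Real.exp_neg]; field_simp
  · rintro S - - ⟨i, hi, hij⟩
    refine ⟨i, hi, fun j hj => ?_⟩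
    obtain ⟨z, hz1, hz2⟩ := hij j hj
    change ‖H (z - t⁻¹ • x i)‖ ≤ _ at hz1
    change ‖H (z - t⁻¹ • x j)‖ ≤ _ at hz2
    have e : x j - x i = t • ((z - t⁻¹ • x i) - (z - t⁻¹ • x j)) := by
      rw [sub_sub_sub_cancel_left, smul_sub, smul_smul, smul_smul, mul_inv_cancel₀ ht.ne',
        one_smul, one_smul]
    rw [e, map_smul, norm_smul, Real.norm_of_nonneg ht.le, map_sub]
    have := norm_sub_le (H (z - t⁻¹ • x i)) (H (z - t⁻¹ • x j))
    calc _ ≤ t * (sechTau * h + sechTau * h) := by gcongr; linarith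
      _ = _ := by ring

/-- The packed sets vary with `i`: besides z and w in general position they require A(xᵢ,·) and
A(·,yᵢ) to be small at w and z, which controls the cross terms of the bilinear increment. Each of
the five constraints fails with probability at most 1/16. -/
lemma coveredBy_bilinear (T : Finset I) (x y : I → ι → ℝ) {t κ κ' h a : ℝ} (ht : 0 < t)
    (hx : ∀ i ∈ T, ∏ k, Real.cosh (t⁻¹ * x i k) ≤ Real.exp κ)
    (hy : ∀ i ∈ T, ∏ k, Real.cosh (t⁻¹ * y i k) ≤ Real.exp κ')
    (A : (ι → ℝ) →ₗ[ℝ] (ι → ℝ) →ₗ[ℝ] F) (h0 : 0 < h) (a0 : 0 < a)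
    (hA : hsSq (hsMap A) ≤ a ^ 2) (hAx : ∀ i ∈ T, ‖hsMap A (x i)‖ ≤ h)
    (hAy : ∀ i ∈ T, ‖hsMap A.flip (y i)‖ ≤ h) :
    CoveredBy T (2 * Real.exp (κ + κ'))
      (fun S => ∃ i ∈ S, ∀ j ∈ S, ‖hsMap A (x j - x i)‖ ≤ 2 * sechTau * t * a ∧
        ‖hsMap A.flip (y j - y i)‖ ≤ 2 * sechTau * t * a ∧
        ‖A (x j) (y j) - A (x i) (y i)‖ ≤
          2 * (2 * sechTau * t * h + sechTau ^ 2 * t ^ 2 * a)) := by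
  set K : I → Set ((ι → ℝ) × (ι → ℝ)) := fun i =>
    {q | (‖hsMap A q.1‖ ≤ sechTau * a ∧ ‖hsMap A.flip q.2‖ ≤ sechTau * a) ∧
      ((‖A (x i) q.2‖ ≤ sechTau * h ∧ ‖A.flip (y i) q.1‖ ≤ sechTau * h) ∧
        ‖A q.1 q.2‖ ≤ sechTau ^ 2 * a)} with hK
  have c1 := continuous_linearMap_pi (hsMap A)
  have c2 := continuous_linearMap_pi (hsMap A.flip)
  have c3 := continuous_bilin_pi A
  have hKm : ∀ i, MeasurableSet (K i) := by
    intro i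
    have c4 := continuous_linearMap_pi (A (x i))
    have c5 := continuous_linearMap_pi (A.flip (y i))
    refine IsClosed.measurableSet ?_
    exact ((isClosed_le (c1.comp continuous_fst).norm continuous_const).inter
      (isClosed_le (c2.comp continuous_snd).norm continuous_const)).inter
      (((isClosed_le (c4.comp continuous_snd).norm continuous_const).inter
        (isClosed_le (c5.comp continuous_fst).norm continuous_const)).inter
        (isClosed_le c3.norm continuous_const))
  have hKs : ∀ i, ∀ q ∈ K i, -q ∈ K i := by
    rintro i q ⟨⟨h1, h2⟩, ⟨h3, h4⟩, h5⟩
    refine ⟨⟨?_, ?_⟩, ⟨?_, ?_⟩, ?_⟩ <;>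
      simpa only [Prod.fst_neg, Prod.snd_neg, map_neg, norm_neg, LinearMap.neg_apply, neg_neg]
  have hKμ : ∀ i ∈ T, ENNReal.ofReal (1 / 2) ≤ ((sechPi ι).prod (sechPi ι)) (K i) := by
    intro i hi
    refine half_le_measure_of_compl _ (hKm i) ?_
    have hxi : hsSq (A (x i)) ≤ h ^ 2 := by
      rw [← norm_hsMap_sq]
      have := hAx i hi
      gcongr
    have hyi : hsSq (A.flip (y i)) ≤ h ^ 2 := by
      rw [← norm_hsMap_sq]
      have := hAy i hi
      gcongr
    have hsub : (K i)ᶜ ⊆ ({q | sechTau * a < ‖hsMap A q.1‖} ∪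
        {q | sechTau * a < ‖hsMap A.flip q.2‖}) ∪ (({q | sechTau * h < ‖A (x i) q.2‖} ∪
          {q | sechTau * h < ‖A.flip (y i) q.1‖}) ∪
          {q : (ι → ℝ) × (ι → ℝ) | sechTau ^ 2 * a < ‖A q.1 q.2‖}) := by
      intro q hq
      by_contra hcon
      refine hq ?_
      simp only [Set.mem_union, not_or] at hcon
      obtain ⟨⟨h1, h2⟩, ⟨h3, h4⟩, h5⟩ := hcon
      exact ⟨⟨not_lt.1 h1, not_lt.1 h2⟩, ⟨not_lt.1 h3, not_lt.1 h4⟩, not_lt.1 h5⟩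
    refine (measure_mono hsub).trans ?_
    have e1 := sechPi_prod_norm_fst_gt_le (hsMap A) a0 hA
    have e2 := sechPi_prod_norm_snd_gt_le (hsMap A.flip) a0 (by rwa [hsSq_hsMap_flip])
    have e3 := sechPi_prod_norm_snd_gt_le (A (x i)) h0 hxi
    have e4 := sechPi_prod_norm_fst_gt_le (A.flip (y i)) h0 hyi
    have e5 := sechPi_prod_norm_gt_le A a0 hA
    exact measure_union_five_le _ e1 e2 e3 e4 e5
  have hm : (0 : ℝ) < Real.exp (-(κ + κ')) * (1 / 2) := by positivity
  have key := coveredBy_of_measure_ge ((sechPi ι).prod (sechPi ι)) T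
    (fun i => {q | q - (t⁻¹ • x i, t⁻¹ • y i) ∈ K i})
    (fun i _ => (hKm i).preimage (measurable_sub_const _)) hm
    (fun i hi => by
      rw [ENNReal.ofReal_mul (Real.exp_pos _).le]
      refine le_trans (mul_le_mul_right (hKμ i hi) _) ?_
      exact sechPi_prod_translate_ge (t⁻¹ • x i) (t⁻¹ • y i) (hx i hi) (hy i hi) (K i)
        (hKm i) (hKs i))
  refine key.mono (le_of_eq ?_) ?_
  · rw [Real.exp_neg]; field_simp
  · rintro S - - ⟨i, hi, hij⟩
    refine ⟨i, hi, fun j hj => ?_⟩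
    obtain ⟨⟨z, w⟩, hz1, hz2⟩ := hij j hj
    have exp1 : ∀ k, x k + t • (z - t⁻¹ • x k) = t • z := by
      intro k
      rw [smul_sub, smul_smul, mul_inv_cancel₀ ht.ne', one_smul, add_sub_cancel]
    have exp2 : ∀ k, y k + t • (w - t⁻¹ • y k) = t • w := by
      intro k
      rw [smul_sub, smul_smul, mul_inv_cancel₀ ht.ne', one_smul, add_sub_cancel]
    -- Both indices are compared with the common point (tz, tw). Expanding A(x+tu, y+tv) - A(x,y)
    -- gives tA(x,v) + tA(u,y) + t²A(u,v), one term for each of the last three constraints in `K k`.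
    have hball : ∀ k, ((z, w) : (ι → ℝ) × (ι → ℝ)) ∈
        {q | q - (t⁻¹ • x k, t⁻¹ • y k) ∈ K k} →
        ‖hsMap A (t • z - x k)‖ ≤ sechTau * t * a ∧
        ‖hsMap A.flip (t • w - y k)‖ ≤ sechTau * t * a ∧
        ‖A (t • z) (t • w) - A (x k) (y k)‖ ≤
          2 * sechTau * t * h + sechTau ^ 2 * t ^ 2 * a := by
      rintro k ⟨⟨h1, h2⟩, ⟨h3, h4⟩, h5⟩
      change ‖hsMap A (z - t⁻¹ • x k)‖ ≤ _ at h1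
      change ‖hsMap A.flip (w - t⁻¹ • y k)‖ ≤ _ at h2
      change ‖A (x k) (w - t⁻¹ • y k)‖ ≤ _ at h3
      change ‖A (z - t⁻¹ • x k) (y k)‖ ≤ _ at h4
      change ‖A (z - t⁻¹ • x k) (w - t⁻¹ • y k)‖ ≤ _ at h5
      rw [← exp1 k, ← exp2 k]
      set u := z - t⁻¹ • x k
      set v := w - t⁻¹ • y k
      refine ⟨?_, ?_, ?_⟩
      · rw [add_sub_cancel_left, map_smul, norm_smul, Real.norm_of_nonneg ht.le]
        nlinarith
      · rw [add_sub_cancel_left, map_smul, norm_smul, Real.norm_of_nonneg ht.le]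
        nlinarith
      · have e : A (x k + t • u) (y k + t • v) - A (x k) (y k) =
            t • A (x k) v + t • A u (y k) + (t * t) • A u v := by
          simp only [map_add, map_smul, LinearMap.add_apply, LinearMap.smul_apply, smul_smul,
            smul_add]
          abel
        rw [e]
        refine (norm_add₃_le).trans ?_
        rw [norm_smul, norm_smul, norm_smul, Real.norm_of_nonneg ht.le,
          Real.norm_of_nonneg (mul_pos ht ht).le]
        have := mul_le_mul_of_nonneg_left h3 ht.le
        have := mul_le_mul_of_nonneg_left h4 ht.le
        have := mul_le_mul_of_nonneg_left h5 (mul_pos ht ht).le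
        nlinarith
    obtain ⟨a1, a2, a3⟩ := hball i hz1
    obtain ⟨b1, b2, b3⟩ := hball j hz2
    refine ⟨?_, ?_, ?_⟩
    · rw [show x j - x i = (t • z - x i) - (t • z - x j) by abel, map_sub]
      exact (norm_sub_le _ _).trans (by linarith)
    · rw [show y j - y i = (t • w - y i) - (t • w - y j) by abel, map_sub]
      exact (norm_sub_le _ _).trans (by linarith)
    · rw [show A (x j) (y j) - A (x i) (y i) = (A (t • z) (t • w) - A (x i) (y i)) -
        (A (t • z) (t • w) - A (x j) (y j)) by abel]
      exact (norm_sub_le _ _).trans (by linarith)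

end Covering

/-! ### Gaussian width of finite families -/

section Width

variable {E : Type*} [NormedAddCommGroup E] [InnerProductSpace ℝ E] [FiniteDimensional ℝ E]
  [MeasurableSpace E] [BorelSpace E]

lemma map_inner_stdGaussian (s : E) :
    (stdGaussian E).map (fun g => inner ℝ s g) = gaussianReal 0 (‖s‖ ^ 2).toNNReal := by
  have h := IsGaussian.map_eq_gaussianReal (μ := stdGaussian E) (innerSL ℝ s)
  rw [integral_strongDual_stdGaussian, variance_dual_stdGaussian, innerSL_apply_norm] at h
  exact h

lemma integrable_inner_stdGaussian (s : E) :
    Integrable (fun g => inner ℝ s g) (stdGaussian E) :=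
  IsGaussian.integrable_id.const_inner s

lemma integral_inner_stdGaussian (s : E) : ∫ g, inner ℝ s g ∂stdGaussian E = 0 :=
  integral_strongDual_stdGaussian (innerSL ℝ s)

lemma integrable_exp_inner_stdGaussian (s : E) :
    Integrable (fun g => Real.exp (inner ℝ s g)) (stdGaussian E) := by
  have h := integrable_exp_mul_gaussianReal (μ := 0) (v := (‖s‖ ^ 2).toNNReal) 1
  rw [← map_inner_stdGaussian, integrable_map_measure (by fun_prop) (by fun_prop)] at h
  simpa [Function.comp_def] using h

lemma integral_exp_inner_stdGaussian (s : E) :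
    ∫ g, Real.exp (inner ℝ s g) ∂stdGaussian E = Real.exp (‖s‖ ^ 2 / 2) := by
  have h := mgf_gaussianReal (map_inner_stdGaussian s) 1
  simpa [mgf] using h

lemma integrable_inner_sq_stdGaussian (s : E) :
    Integrable (fun g => (inner ℝ s g : ℝ) ^ 2) (stdGaussian E) := by
  have h := IsGaussian.memLp_id (stdGaussian E) 2 (by simp)
  have h2 : MemLp (fun g => (inner ℝ s g : ℝ)) 2 (stdGaussian E) := h.const_inner s
  exact h2.integrable_sq

lemma integral_inner_sq_stdGaussian (s : E) :
    ∫ g, (inner ℝ s g : ℝ) ^ 2 ∂stdGaussian E = ‖s‖ ^ 2 := by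
  have h := variance_dual_stdGaussian (innerSL ℝ s)
  rw [variance_of_integral_eq_zero (innerSL ℝ s).continuous.aemeasurable
    (integral_strongDual_stdGaussian _), innerSL_apply_norm] at h
  exact h

/-- Jensen's inequality for the exponential. -/
lemma exp_integral_le_lintegral {Ω : Type*} [MeasurableSpace Ω] (μ : Measure Ω)
    [IsProbabilityMeasure μ] {f : Ω → ℝ} (hf : Integrable f μ) :
    ENNReal.ofReal (Real.exp (∫ ω, f ω ∂μ)) ≤ ∫⁻ ω, ENNReal.ofReal (Real.exp (f ω)) ∂μ := by
  by_cases h : Integrable (fun ω => Real.exp (f ω)) μ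
  · rw [← ofReal_integral_eq_lintegral_ofReal h
      (Filter.Eventually.of_forall fun g => (Real.exp_pos _).le)]
    exact ENNReal.ofReal_le_ofReal (convexOn_exp.map_integral_le Real.continuous_exp.continuousOn
      isClosed_univ (by simp) hf h)
  · have hm : AEStronglyMeasurable (fun ω => Real.exp (f ω)) μ :=
      Real.continuous_exp.comp_aestronglyMeasurable hf.1
    have : ∫⁻ ω, ENNReal.ofReal (Real.exp (f ω)) ∂μ = ⊤ := by
      by_contra hne
      exact h ((lintegral_ofReal_ne_top_iff_integrable hm
        (Filter.Eventually.of_forall fun g => (Real.exp_pos _).le)).1 hne)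
    rw [this]
    exact le_top

variable {I : Type*}

/-- The support function of the finite family `φ i`, `i ∈ T`. -/
def supInner (T : Finset I) (φ : I → E) (g : E) : ℝ := ⨆ i : T, (inner ℝ (φ i) g : ℝ)

/-- The Gaussian width of the finite family `φ i`, `i ∈ T`. -/
def width (T : Finset I) (φ : I → E) : ℝ := ∫ g, supInner T φ g ∂stdGaussian E

variable {T S : Finset I} {φ ψ : I → E}

omit [FiniteDimensional ℝ E] [MeasurableSpace E] [BorelSpace E] in
lemma le_supInner {i : I} (hi : i ∈ T) (g : E) : inner ℝ (φ i) g ≤ supInner T φ g :=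
  le_ciSup (f := fun i : T => (inner ℝ (φ i) g : ℝ)) (Set.finite_range _).bddAbove ⟨i, hi⟩

omit [FiniteDimensional ℝ E] [MeasurableSpace E] [BorelSpace E] in
lemma supInner_le (hT : T.Nonempty) {g : E} {c : ℝ} (h : ∀ i ∈ T, inner ℝ (φ i) g ≤ c) :
    supInner T φ g ≤ c := by
  have : Nonempty T := hT.to_subtype
  exact ciSup_le fun i => h i i.2

omit [FiniteDimensional ℝ E] in
lemma measurable_supInner (T : Finset I) (φ : I → E) : Measurable (supInner T φ) :=
  Measurable.iSup fun _ => (continuous_const.inner continuous_id).measurable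

lemma integrable_supInner (hT : T.Nonempty) (φ : I → E) :
    Integrable (supInner T φ) (stdGaussian E) := by
  have hi : Integrable (fun g => ∑ i ∈ T, |(inner ℝ (φ i) g : ℝ)|) (stdGaussian E) :=
    integrable_finsetSum _ fun i _ => (integrable_inner_stdGaussian (φ i)).abs
  refine hi.mono' (measurable_supInner T φ).aestronglyMeasurable
    (Filter.Eventually.of_forall fun g => ?_)
  have hle : ∀ i ∈ T, |(inner ℝ (φ i) g : ℝ)| ≤ ∑ i ∈ T, |(inner ℝ (φ i) g : ℝ)| :=
    fun i hi => Finset.single_le_sum (f := fun i => |(inner ℝ (φ i) g : ℝ)|)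
      (fun j _ => abs_nonneg _) hi
  rw [Real.norm_eq_abs, abs_le]
  obtain ⟨i, hi⟩ := hT
  constructor
  · exact (neg_le_neg (hle i hi)).trans ((neg_abs_le _).trans (le_supInner hi g))
  · exact supInner_le ⟨i, hi⟩ fun j hj => (le_abs_self _).trans (hle j hj)

lemma width_le_integral (hT : T.Nonempty) {f : E → ℝ} (hf : Integrable f (stdGaussian E))
    (h : ∀ i ∈ T, ∀ g, inner ℝ (φ i) g ≤ f g) : width T φ ≤ ∫ g, f g ∂stdGaussian E :=
  integral_mono (integrable_supInner hT φ) hf fun g => supInner_le hT fun i hi => h i hi g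

lemma width_mono (hS : S.Nonempty) (h : S ⊆ T) : width S φ ≤ width T φ :=
  width_le_integral hS (integrable_supInner (hS.mono h) φ) fun _ hi _ => le_supInner (h hi) _

lemma width_add_le (hT : T.Nonempty) (φ ψ : I → E) :
    width T (fun i => φ i + ψ i) ≤ width T φ + width T ψ := by
  have h1 := integrable_supInner hT φ
  have h2 := integrable_supInner hT ψ
  rw [width.eq_1 T φ, width.eq_1 T ψ, ← integral_add h1 h2]
  refine width_le_integral hT (h1.add h2) fun i hi g => ?_
  rw [inner_add_left]
  exact add_le_add (le_supInner hi g) (le_supInner hi g)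

lemma width_const_le (hT : T.Nonempty) (v : E) : width T (fun _ => v) ≤ 0 := by
  rw [← integral_inner_stdGaussian v]
  exact width_le_integral hT (integrable_inner_stdGaussian v) fun i _ g => le_rfl

/-- A fixed linear functional of the Gaussian is centred, so recentring a family is free. -/
lemma width_sub_const (hT : T.Nonempty) (φ : I → E) (v : E) :
    width T (fun i => φ i - v) = width T φ := by
  apply le_antisymm
  · have := width_add_le hT φ (fun _ => -v)
    simp only [← sub_eq_add_neg] at this
    linarith [width_const_le hT (-v)]
  · have := width_add_le hT (fun i => φ i - v) (fun _ => v)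
    simp only [sub_add_cancel] at this
    linarith [width_const_le hT v]

omit [BorelSpace E] in
lemma width_congr (h : ∀ i ∈ T, φ i = ψ i) : width T φ = width T ψ := by
  unfold width supInner
  congr 1
  ext g
  exact iSup_congr fun i => by rw [h i i.2]

/-- A dimension-dependent bound, used only to start the inductions, where its contribution is
multiplied by powers of 1/2 and disappears in the limit. -/
lemma width_le_mul_integral_norm (hT : T.Nonempty) {D : ℝ}
    (hD : ∀ i ∈ T, ∀ j ∈ T, ‖φ i - φ j‖ ≤ D) :
    width T φ ≤ D * ∫ g, ‖g‖ ∂stdGaussian E := by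
  obtain ⟨j, hj⟩ := hT
  rw [← width_sub_const ⟨j, hj⟩ φ (φ j), ← integral_const_mul]
  refine width_le_integral ⟨j, hj⟩ (IsGaussian.integrable_id.norm.const_mul D) fun i hi g => ?_
  exact (real_inner_le_norm _ _).trans
    (mul_le_mul_of_nonneg_right (hD i hi j hj) (norm_nonneg _))

/-- By Cauchy–Schwarz ⟨Bx,g⟩² ≤ Q(g), and Q has mean s² = `hsSq B`. Instead of integrating √Q, the
proof uses v ≤ (v² + s²)/(2s), which needs s > 0; the case s = 0 is separate. -/
lemma width_ball_le {ι : Type*} [Fintype ι] [DecidableEq ι] (hT : T.Nonempty) (x : I → ι → ℝ)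
    (hx : ∀ i ∈ T, ∑ k, x i k ^ 2 ≤ 1) (B : (ι → ℝ) →ₗ[ℝ] E) :
    width T (fun i => B (x i)) ≤ √(hsSq B) := by
  set Q : E → ℝ := fun g => ∑ k, (inner ℝ (B (Pi.single k 1)) g : ℝ) ^ 2 with hQ
  have hQ0 : ∀ g, 0 ≤ Q g := fun g => Finset.sum_nonneg fun _ _ => sq_nonneg _
  have hQi : Integrable Q (stdGaussian E) :=
    integrable_finsetSum _ fun k _ => integrable_inner_sq_stdGaussian _
  have hQv : ∫ g, Q g ∂stdGaussian E = hsSq B := by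
    rw [hQ, integral_finsetSum _ fun k _ => integrable_inner_sq_stdGaussian _]
    simp_rw [integral_inner_sq_stdGaussian]
    rfl
  have hB : ∀ z : ι → ℝ, B z = ∑ k, z k • B (Pi.single k 1) := by
    intro z
    conv_lhs => rw [LinearMap.pi_apply_eq_sum_univ B z]
    refine Finset.sum_congr rfl fun k _ => ?_
    congr 2
    ext j
    simp [Pi.single_apply, eq_comm]
  rcases (hsSq_nonneg B).eq_or_lt with h0 | hpos
  · have hz : ∀ k, B (Pi.single k 1) = 0 := by
      intro k
      have := (Finset.sum_eq_zero_iff_of_nonneg fun k _ => sq_nonneg _).1 h0.symm k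
        (Finset.mem_univ k)
      simpa using this
    have : width T (fun i => B (x i)) = width T (fun _ => (0 : E)) :=
      width_congr fun i _ => by rw [hB]; simp [hz]
    rw [this]
    exact (width_const_le hT 0).trans (Real.sqrt_nonneg _)
  · set s := √(hsSq B) with hs
    have hs0 : 0 < s := Real.sqrt_pos.2 hpos
    have hss : s ^ 2 = hsSq B := Real.sq_sqrt hpos.le
    have hint : Integrable (fun g => (2 * s)⁻¹ * (Q g + s ^ 2)) (stdGaussian E) :=
      (hQi.add (integrable_const _)).const_mul _
    have hval : ∫ g, (2 * s)⁻¹ * (Q g + s ^ 2) ∂stdGaussian E = s := by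
      rw [integral_const_mul, integral_add hQi (integrable_const _), hQv, ← hss]
      simp
      field_simp
      norm_num
    rw [← hval]
    refine width_le_integral hT hint fun i hi g => ?_
    have h1 : (inner ℝ (B (x i)) g : ℝ) = ∑ k, x i k * inner ℝ (B (Pi.single k 1)) g := by
      rw [hB, sum_inner]
      simp_rw [real_inner_smul_left]
    have h2 : (inner ℝ (B (x i)) g : ℝ) ^ 2 ≤ Q g := by
      rw [h1]
      refine (Finset.sum_mul_sq_le_sq_mul_sq _ _ _).trans ?_
      exact mul_le_of_le_one_left (hQ0 g) (hx i hi)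
    rw [inv_mul_eq_div, le_div_iff₀ (by positivity)]
    nlinarith [sq_nonneg ((inner ℝ (B (x i)) g : ℝ) - s)]

end Width

/-! ### Gaussian concentration and the width of a union -/

section Concentration

variable {E : Type*} [NormedAddCommGroup E] [InnerProductSpace ℝ E] {I : Type*}

/-- The partition function of the finite family `ψ i`, `i ∈ S`. -/
def expSum (S : Finset I) (ψ : I → E) (x : E) : ℝ := ∑ i ∈ S, Real.exp (inner ℝ (ψ i) x)

/-- The smooth maximum of the family `ψ i`, `i ∈ S`, at inverse temperature `β`. -/
def softMax (S : Finset I) (ψ : I → E) (β : ℝ) (x : E) : ℝ :=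
  β⁻¹ * Real.log (expSum S (fun i => β • ψ i) x)

variable {S : Finset I} {ψ : I → E} {β : ℝ}

lemma expSum_pos (hS : S.Nonempty) (ψ : I → E) (x : E) : 0 < expSum S ψ x :=
  Finset.sum_pos (fun _ _ => Real.exp_pos _) hS

lemma continuous_expSum (S : Finset I) (ψ : I → E) : Continuous (expSum S ψ) :=
  continuous_finsetSum _ fun _ _ => by fun_prop

lemma continuous_softMax (hS : S.Nonempty) (ψ : I → E) (β : ℝ) : Continuous (softMax S ψ β) :=
  continuous_const.mul ((continuous_expSum S _).log fun x => (expSum_pos hS _ x).ne')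

lemma inner_le_softMax (hβ : 0 < β) {i : I} (hi : i ∈ S) (x : E) :
    inner ℝ (ψ i) x ≤ softMax S ψ β x := by
  have hS : S.Nonempty := ⟨i, hi⟩
  rw [softMax, inv_mul_eq_div, le_div_iff₀ hβ, Real.le_log_iff_exp_le (expSum_pos hS _ x)]
  have := Finset.single_le_sum (f := fun i => Real.exp (inner ℝ (β • ψ i) x))
    (fun j _ => (Real.exp_pos _).le) hi
  refine le_trans (le_of_eq ?_) this
  rw [real_inner_smul_left, mul_comm]

lemma softMax_le (hβ : 0 < β) (hS : S.Nonempty) (x : E) :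
    softMax S ψ β x ≤ supInner S ψ x + Real.log S.card / β := by
  have hc : (0 : ℝ) < S.card := by exact_mod_cast hS.card_pos
  have h1 : expSum S (fun i => β • ψ i) x ≤ S.card * Real.exp (β * supInner S ψ x) := by
    rw [← nsmul_eq_mul]
    refine Finset.sum_le_card_nsmul _ _ _ fun i hi => Real.exp_le_exp.2 ?_
    rw [real_inner_smul_left]
    exact mul_le_mul_of_nonneg_left (le_supInner hi x) hβ.le
  have h2 := Real.log_le_log (expSum_pos hS _ x) h1
  rw [Real.log_mul hc.ne' (Real.exp_pos _).ne', Real.log_exp] at h2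
  rw [softMax, inv_mul_eq_div, div_le_iff₀ hβ, add_mul, div_mul_cancel₀ _ hβ.ne']
  linarith

/-- The directional derivative of the smooth maximum. -/
def softMaxDeriv (S : Finset I) (ψ : I → E) (β : ℝ) (x v : E) : ℝ :=
  (∑ i ∈ S, Real.exp (inner ℝ (β • ψ i) x) * inner ℝ (ψ i) v) / expSum S (fun i => β • ψ i) x

lemma continuous_softMaxDeriv (hS : S.Nonempty) (ψ : I → E) (β : ℝ) :
    Continuous fun q : E × E => softMaxDeriv S ψ β q.1 q.2 := by
  refine Continuous.div (continuous_finsetSum _ fun i _ => by fun_prop) ?_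
    fun q => (expSum_pos hS _ q.1).ne'
  exact (continuous_expSum S _).comp continuous_fst

lemma hasDerivAt_softMax (hβ : β ≠ 0) (hS : S.Nonempty) {c : ℝ → E} {c' : E} {θ : ℝ}
    (hc : HasDerivAt c c' θ) :
    HasDerivAt (fun θ => softMax S ψ β (c θ)) (softMaxDeriv S ψ β (c θ) c') θ := by
  have h1 : ∀ i, HasDerivAt (fun θ => (inner ℝ (β • ψ i) (c θ) : ℝ))
      (inner ℝ (β • ψ i) c') θ := fun i =>
    (innerSL ℝ (β • ψ i)).hasFDerivAt.comp_hasDerivAt θ hc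
  have h2 : HasDerivAt (fun θ => expSum S (fun i => β • ψ i) (c θ))
      (∑ i ∈ S, Real.exp (inner ℝ (β • ψ i) (c θ)) * inner ℝ (β • ψ i) c') θ :=
    HasDerivAt.fun_sum fun i _ => (h1 i).exp
  have h3 := (h2.log (expSum_pos hS _ _).ne').const_mul β⁻¹
  refine h3.congr_deriv ?_
  rw [softMaxDeriv, mul_div_assoc', Finset.mul_sum]
  congr 1
  refine Finset.sum_congr rfl fun i _ => ?_
  rw [real_inner_smul_left (ψ i) c' β]
  field_simp

lemma softMaxDeriv_smul (c : ℝ) (x v : E) :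
    softMaxDeriv S ψ β x (c • v) = c * softMaxDeriv S ψ β x v := by
  simp only [softMaxDeriv, real_inner_smul_right]
  rw [mul_div_assoc', Finset.mul_sum]
  congr 1
  exact Finset.sum_congr rfl fun i _ => by ring

/-- Convexity of the exponential for the Gibbs weights. -/
lemma exp_softMaxDeriv_le (hS : S.Nonempty) (c : ℝ) (x v : E) :
    Real.exp (c * softMaxDeriv S ψ β x v) ≤
      ∑ i ∈ S, Real.exp (inner ℝ (β • ψ i) x) / expSum S (fun i => β • ψ i) x *
        Real.exp (inner ℝ (c • ψ i) v) := by
  have hZ := expSum_pos hS (fun i => β • ψ i) x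
  have h := convexOn_exp.map_sum_le (t := S)
    (w := fun i => Real.exp (inner ℝ (β • ψ i) x) / expSum S (fun i => β • ψ i) x)
    (p := fun i => (inner ℝ (c • ψ i) v : ℝ)) (fun i _ => by positivity)
    (by rw [← Finset.sum_div]; exact div_self hZ.ne') (fun _ _ => Set.mem_univ _)
  simp only [smul_eq_mul] at h
  refine le_trans (le_of_eq ?_) h
  congr 1
  rw [softMaxDeriv, mul_div_assoc', Finset.mul_sum, Finset.sum_div]
  refine Finset.sum_congr rfl fun i _ => ?_
  rw [real_inner_smul_left (ψ i) v c]
  ring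

variable [FiniteDimensional ℝ E] [MeasurableSpace E] [BorelSpace E]

/-- For fixed `x` the derivative is a Gibbs average of the Gaussian variables ⟨ψᵢ,v⟩, each of
variance at most `D ^ 2`, and the exponential is convex. -/
lemma lintegral_exp_softMaxDeriv_le (hS : S.Nonempty) {D : ℝ} (hD : ∀ i ∈ S, ‖ψ i‖ ≤ D)
    (c : ℝ) (x : E) :
    ∫⁻ v, ENNReal.ofReal (Real.exp (c * softMaxDeriv S ψ β x v)) ∂stdGaussian E ≤
      ENNReal.ofReal (Real.exp (c ^ 2 * D ^ 2 / 2)) := by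
  have hZ := expSum_pos hS (fun i => β • ψ i) x
  have hint : ∀ i ∈ S, Integrable (fun v => Real.exp (inner ℝ (β • ψ i) x) /
      expSum S (fun i => β • ψ i) x * Real.exp (inner ℝ (c • ψ i) v)) (stdGaussian E) :=
    fun i _ => (integrable_exp_inner_stdGaussian _).const_mul _
  calc _ ≤ ∫⁻ v, ENNReal.ofReal (∑ i ∈ S, Real.exp (inner ℝ (β • ψ i) x) /
        expSum S (fun i => β • ψ i) x * Real.exp (inner ℝ (c • ψ i) v)) ∂stdGaussian E :=
        lintegral_mono fun v => ENNReal.ofReal_le_ofReal (exp_softMaxDeriv_le hS c x v)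
    _ = ENNReal.ofReal (∑ i ∈ S, Real.exp (inner ℝ (β • ψ i) x) /
        expSum S (fun i => β • ψ i) x * Real.exp (‖c • ψ i‖ ^ 2 / 2)) := by
        rw [← ofReal_integral_eq_lintegral_ofReal (integrable_finsetSum _ hint)
          (Filter.Eventually.of_forall fun v => Finset.sum_nonneg fun i _ => by positivity),
          integral_finsetSum _ hint]
        simp_rw [integral_const_mul, integral_exp_inner_stdGaussian]
    _ ≤ _ := by
        refine ENNReal.ofReal_le_ofReal ?_
        calc _ ≤ ∑ i ∈ S, Real.exp (inner ℝ (β • ψ i) x) / expSum S (fun i => β • ψ i) x *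
              Real.exp (c ^ 2 * D ^ 2 / 2) := by
              refine Finset.sum_le_sum fun i hi => ?_
              rw [norm_smul, mul_pow, Real.norm_eq_abs, sq_abs]
              have := hD i hi
              gcongr
          _ = _ := by
              rw [← Finset.sum_mul, ← Finset.sum_div]
              have : (∑ i ∈ S, Real.exp (inner ℝ (β • ψ i) x)) / expSum S (fun i => β • ψ i) x
                = 1 := div_self hZ.ne'
              rw [this, one_mul]

omit [FiniteDimensional ℝ E] [MeasurableSpace E] [BorelSpace E] in
/-- The increment of the smooth maximum along a quarter circle. -/
lemma softMax_sub_eq_integral (hβ : β ≠ 0) (hS : S.Nonempty) (q : E × E) :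
    softMax S ψ β q.2 - softMax S ψ β q.1 = ∫ s in (0 : ℝ)..1, Real.pi / 2 *
      softMaxDeriv S ψ β (ContinuousLinearMap.rotation (s * (Real.pi / 2)) q).1
        (ContinuousLinearMap.rotation (s * (Real.pi / 2)) q).2 := by
  have hderiv : ∀ s : ℝ, HasDerivAt
      (fun s : ℝ => softMax S ψ β (ContinuousLinearMap.rotation (s * (Real.pi / 2)) q).1)
      (Real.pi / 2 * softMaxDeriv S ψ β (ContinuousLinearMap.rotation (s * (Real.pi / 2)) q).1
        (ContinuousLinearMap.rotation (s * (Real.pi / 2)) q).2) s := by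
    intro s
    have h0 : HasDerivAt (fun s : ℝ => s * (Real.pi / 2)) (Real.pi / 2) s := by
      simpa using (hasDerivAt_id s).mul_const (Real.pi / 2)
    have h1 := (h0.cos.smul_const q.1).fun_add (h0.sin.smul_const q.2)
    refine (hasDerivAt_softMax (ψ := ψ) hβ hS h1).congr_deriv ?_
    simp only [ContinuousLinearMap.rotation_apply]
    rw [← softMaxDeriv_smul]
    congr 1
    rw [smul_add, smul_smul, smul_smul, mul_comm (Real.pi / 2), mul_comm (Real.pi / 2)]
  have hcont : Continuous fun s : ℝ => Real.pi / 2 *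
      softMaxDeriv S ψ β (ContinuousLinearMap.rotation (s * (Real.pi / 2)) q).1
        (ContinuousLinearMap.rotation (s * (Real.pi / 2)) q).2 := by
    refine continuous_const.mul ((continuous_softMaxDeriv hS ψ β).comp ?_)
    simp only [ContinuousLinearMap.rotation_apply]
    fun_prop
  rw [intervalIntegral.integral_eq_sub_of_hasDerivAt (fun s _ => hderiv s)
    (hcont.intervalIntegrable _ _)]
  simp [ContinuousLinearMap.rotation_apply]

/-- Averaging a function over a quarter circle does not increase its exponential moment under a
rotation invariant Gaussian measure. -/
lemma lintegral_exp_rotation_average_le (G : E × E → ℝ) (hG : Continuous G) :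
    ∫⁻ q, ENNReal.ofReal (Real.exp (∫ s in (0 : ℝ)..1,
      G (ContinuousLinearMap.rotation (s * (Real.pi / 2)) q)))
        ∂((stdGaussian E).prod (stdGaussian E)) ≤
    ∫⁻ q, ENNReal.ofReal (Real.exp (G q)) ∂((stdGaussian E).prod (stdGaussian E)) := by
  have hprob : IsProbabilityMeasure (volume.restrict (Set.Ioc (0 : ℝ) 1)) := ⟨by simp⟩
  have hrot : Continuous fun r : ℝ × (E × E) =>
      ContinuousLinearMap.rotation (r.1 * (Real.pi / 2)) r.2 := by
    simp only [ContinuousLinearMap.rotation_apply]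
    fun_prop
  have hGrot : Continuous fun r : ℝ × (E × E) =>
      G (ContinuousLinearMap.rotation (r.1 * (Real.pi / 2)) r.2) := hG.comp hrot
  have hJ : ∀ q : E × E, ENNReal.ofReal (Real.exp (∫ s in (0 : ℝ)..1,
      G (ContinuousLinearMap.rotation (s * (Real.pi / 2)) q))) ≤
      ∫⁻ s in Set.Ioc (0 : ℝ) 1, ENNReal.ofReal (Real.exp
        (G (ContinuousLinearMap.rotation (s * (Real.pi / 2)) q))) := by
    intro q
    have hcurve : Continuous fun s : ℝ => ((s, q) : ℝ × (E × E)) := by fun_prop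
    have hi : Integrable (fun s : ℝ => G (ContinuousLinearMap.rotation (s * (Real.pi / 2)) q))
        (volume.restrict (Set.Ioc (0 : ℝ) 1)) := (hGrot.comp hcurve).integrableOn_Ioc
    rw [intervalIntegral.integral_of_le zero_le_one]
    exact exp_integral_le_lintegral _ hi
  have hmp : ∀ θ : ℝ, MeasurePreserving (ContinuousLinearMap.rotation θ : E × E → E × E)
      ((stdGaussian E).prod (stdGaussian E)) ((stdGaussian E).prod (stdGaussian E)) := fun θ =>
    ⟨(ContinuousLinearMap.rotation θ).continuous.measurable,
      IsGaussian.map_rotation_eq_self (by simp) θ⟩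
  have hm : Measurable fun q : E × E => ENNReal.ofReal (Real.exp (G q)) :=
    (Real.continuous_exp.comp hG).measurable.ennreal_ofReal
  refine (lintegral_mono hJ).trans ?_
  rw [lintegral_lintegral_swap]
  · refine le_of_eq ?_
    calc _ = ∫⁻ s in Set.Ioc (0 : ℝ) 1, ∫⁻ q : E × E, ENNReal.ofReal (Real.exp (G q))
          ∂((stdGaussian E).prod (stdGaussian E)) :=
          lintegral_congr fun s => (hmp (s * (Real.pi / 2))).lintegral_comp hm
      _ = _ := by simp
  · exact ((Real.continuous_exp.comp hGrot).comp
      continuous_swap).measurable.ennreal_ofReal.aemeasurable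

/-- The Maurey–Pisier argument: join two independent copies by a quarter circle. Position and
normalised velocity at each time are again independent standard Gaussians, so only the derivative at
a frozen point matters. -/
lemma lintegral_exp_softMax_sub_le (hβ : β ≠ 0) (hS : S.Nonempty) {D : ℝ}
    (hD : ∀ i ∈ S, ‖ψ i‖ ≤ D) (c : ℝ) :
    ∫⁻ q : E × E, ENNReal.ofReal (Real.exp (c * (softMax S ψ β q.2 - softMax S ψ β q.1)))
      ∂((stdGaussian E).prod (stdGaussian E)) ≤
      ENNReal.ofReal (Real.exp ((c * (Real.pi / 2)) ^ 2 * D ^ 2 / 2)) := by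
  have hGc : Continuous fun q : E × E => c * (Real.pi / 2) * softMaxDeriv S ψ β q.1 q.2 :=
    continuous_const.mul (continuous_softMaxDeriv hS ψ β)
  have hm : Measurable fun q : E × E =>
      ENNReal.ofReal (Real.exp (c * (Real.pi / 2) * softMaxDeriv S ψ β q.1 q.2)) :=
    (Real.continuous_exp.comp hGc).measurable.ennreal_ofReal
  refine le_trans (le_of_eq ?_) ((lintegral_exp_rotation_average_le _ hGc).trans ?_)
  · refine lintegral_congr fun q => ?_
    rw [softMax_sub_eq_integral hβ hS, ← intervalIntegral.integral_const_mul]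
    simp only [mul_assoc]
  · rw [lintegral_prod _ hm.aemeasurable]
    refine (lintegral_mono fun x => lintegral_exp_softMaxDeriv_le hS hD _ x).trans ?_
    simp

lemma integrable_softMax (hβ : 0 < β) (hS : S.Nonempty) (ψ : I → E) :
    Integrable (softMax S ψ β) (stdGaussian E) := by
  have hi := (integrable_supInner hS ψ).abs.add
    (integrable_const (μ := stdGaussian E) |Real.log S.card / β|)
  refine hi.mono' (continuous_softMax hS ψ β).aestronglyMeasurable
    (Filter.Eventually.of_forall fun x => ?_)
  have h1 := softMax_le (ψ := ψ) hβ hS x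
  have h2 : supInner S ψ x ≤ softMax S ψ β x := supInner_le hS fun i hi => inner_le_softMax hβ hi x
  simp only [Pi.add_apply, Real.norm_eq_abs]
  rw [abs_le]
  constructor
  · linarith [neg_abs_le (supInner S ψ x), abs_nonneg (Real.log S.card / β)]
  · linarith [le_abs_self (supInner S ψ x), le_abs_self (Real.log S.card / β)]

/-- Gaussian concentration of the smooth maximum. -/
lemma lintegral_exp_softMax_sub_integral_le (hβ : 0 < β) (hS : S.Nonempty) {D : ℝ}
    (hD : ∀ i ∈ S, ‖ψ i‖ ≤ D) (c : ℝ) :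
    ∫⁻ x, ENNReal.ofReal (Real.exp (c * (softMax S ψ β x - ∫ y, softMax S ψ β y ∂stdGaussian E)))
      ∂stdGaussian E ≤
      ENNReal.ofReal (Real.exp ((c * (Real.pi / 2)) ^ 2 * D ^ 2 / 2)) := by
  set γ := stdGaussian E
  set m := ∫ y, softMax S ψ β y ∂γ with hm
  have hc := continuous_softMax hS ψ β
  have hmeas : ∀ c : ℝ, Measurable fun x =>
      ENNReal.ofReal (Real.exp (c * softMax S ψ β x)) := fun c =>
    (Real.continuous_exp.comp (continuous_const.mul hc)).measurable.ennreal_ofReal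
  have h1 := lintegral_exp_softMax_sub_le hβ.ne' hS hD c
  have h2 : ∫⁻ q : E × E, ENNReal.ofReal (Real.exp (c * (softMax S ψ β q.2 - softMax S ψ β q.1)))
      ∂(γ.prod γ) = (∫⁻ x, ENNReal.ofReal (Real.exp (-c * softMax S ψ β x)) ∂γ) *
        ∫⁻ x, ENNReal.ofReal (Real.exp (c * softMax S ψ β x)) ∂γ := by
    rw [← lintegral_prod_mul (hmeas (-c)).aemeasurable (hmeas c).aemeasurable]
    refine lintegral_congr fun q => ?_
    rw [← ENNReal.ofReal_mul (Real.exp_pos _).le, ← Real.exp_add]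
    congr 2
    ring
  rw [h2] at h1
  refine le_trans ?_ h1
  -- Jensen replaces the independent copy by its mean.
  have h3 := exp_integral_le_lintegral γ ((integrable_softMax hβ hS ψ).const_mul (-c))
  rw [integral_const_mul] at h3
  refine le_trans (le_of_eq ?_) (mul_le_mul_left h3 _)
  rw [← lintegral_const_mul _ (hmeas c)]
  refine lintegral_congr fun x => ?_
  rw [← ENNReal.ofReal_mul (Real.exp_pos _).le, ← Real.exp_add]
  congr 2
  ring

variable {T : Finset I} {φ : I → E}

/-- The width of a union of few families exceeds the largest of their widths by little. -/
lemma width_le_of_coveredBy (hT : T.Nonempty) {q m D : ℝ} (hq : 0 < q) (hD : 0 < D)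
    (hφ : ∀ i ∈ T, ∀ j ∈ T, ‖φ i - φ j‖ ≤ D)
    (hC : CoveredBy T (Real.exp q) (fun S => width S φ ≤ m)) :
    width T φ ≤ m + 3 * √q * D := by
  obtain ⟨C, hcard, hcov, hC⟩ := hC
  obtain ⟨i0, hi0⟩ := hT
  have hT : T.Nonempty := ⟨i0, hi0⟩
  set ψ : I → E := fun i => φ i - φ i0 with hψ
  set γ := stdGaussian E
  have hlogT : 0 ≤ Real.log T.card := Real.log_natCast_nonneg _
  -- The soft maximum exceeds the true one by at most log|T|/β on every subfamily. Exponential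
  -- moments are summed over the pieces, and their number contributes `q`.
  have key : ∀ β : ℝ, 0 < β → ∀ c : ℝ, 0 < c →
      c * (width T φ - (m + Real.log T.card / β)) ≤ q + (c * (Real.pi / 2)) ^ 2 * D ^ 2 / 2 := by
    intro β hβ c hc
    set m' := m + Real.log T.card / β
    have hmean : ∀ S ∈ C, ∫ y, softMax S ψ β y ∂γ ≤ m' := by
      intro S hSC
      obtain ⟨hST, hS, hw⟩ := hC S hSC
      calc _ ≤ ∫ y, (supInner S ψ y + Real.log S.card / β) ∂γ :=
            integral_mono (integrable_softMax hβ hS ψ)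
              ((integrable_supInner hS ψ).add (integrable_const _)) fun x => softMax_le hβ hS x
        _ = width S ψ + Real.log S.card / β := by
            rw [integral_add (integrable_supInner hS ψ) (integrable_const _)]
            simp [width]
        _ ≤ m' := by
            rw [hψ, width_sub_const hS]
            have : Real.log S.card ≤ Real.log T.card :=
              Real.log_le_log (by exact_mod_cast hS.card_pos)
                (by exact_mod_cast Finset.card_le_card hST)
            simp only [m']
            gcongr
    have h1 : ∀ x, ENNReal.ofReal (Real.exp (c * (supInner T ψ x - m'))) ≤
        ∑ S ∈ C, ENNReal.ofReal (Real.exp (c * (softMax S ψ β x - ∫ y, softMax S ψ β y ∂γ))) := by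
      intro x
      have : Nonempty T := hT.to_subtype
      obtain ⟨⟨i, hi⟩, hix⟩ := exists_eq_ciSup_of_finite (f := fun i : T => (inner ℝ (ψ i) x : ℝ))
      obtain ⟨S, hSC, hiS⟩ := hcov i hi
      refine le_trans ?_ (Finset.single_le_sum (f := fun S => ENNReal.ofReal (Real.exp (c *
        (softMax S ψ β x - ∫ y, softMax S ψ β y ∂γ)))) (fun _ _ => zero_le) hSC)
      refine ENNReal.ofReal_le_ofReal (Real.exp_le_exp.2 (mul_le_mul_of_nonneg_left ?_ hc.le))
      have e1 : supInner T ψ x = inner ℝ (ψ i) x := hix.symm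
      have e2 := inner_le_softMax (ψ := ψ) hβ hiS x
      linarith [hmean S hSC]
    have hint : Integrable (fun x => c * (supInner T ψ x - m')) γ :=
      ((integrable_supInner hT ψ).sub (integrable_const _)).const_mul c
    have h2 : ENNReal.ofReal (Real.exp (c * (width T φ - m'))) ≤
        ENNReal.ofReal (Real.exp (q + (c * (Real.pi / 2)) ^ 2 * D ^ 2 / 2)) := by
      calc _ = ENNReal.ofReal (Real.exp (∫ x, c * (supInner T ψ x - m') ∂γ)) := by
            rw [integral_const_mul, integral_sub (integrable_supInner hT ψ) (integrable_const _),
              ← width_sub_const hT φ (φ i0)]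
            simp [width, hψ]
        _ ≤ _ := exp_integral_le_lintegral γ hint
        _ ≤ _ := lintegral_mono h1
        _ = ∑ S ∈ C, ∫⁻ x, ENNReal.ofReal (Real.exp (c *
            (softMax S ψ β x - ∫ y, softMax S ψ β y ∂γ))) ∂γ := by
            refine lintegral_finsetSum' _ fun S hSC => Measurable.aemeasurable ?_
            have := (continuous_softMax (hC S hSC).2.1 ψ β).measurable
            fun_prop
        _ ≤ ∑ S ∈ C, ENNReal.ofReal (Real.exp ((c * (Real.pi / 2)) ^ 2 * D ^ 2 / 2)) :=
            Finset.sum_le_sum fun S hSC => lintegral_exp_softMax_sub_integral_le hβ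
              (hC S hSC).2.1 (fun i hi => hφ i ((hC S hSC).1 hi) i0 hi0) c
        _ = ENNReal.ofReal (C.card * Real.exp ((c * (Real.pi / 2)) ^ 2 * D ^ 2 / 2)) := by
            rw [Finset.sum_const, nsmul_eq_mul, ENNReal.ofReal_mul (by positivity),
              ENNReal.ofReal_natCast]
        _ ≤ _ := by
            rw [Real.exp_add]
            exact ENNReal.ofReal_le_ofReal (by gcongr)
    rw [ENNReal.ofReal_le_ofReal_iff (Real.exp_pos _).le, Real.exp_le_exp] at h2
    exact h2
  have hs : 0 < √q := Real.sqrt_pos.2 hq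
  have hss : √q * √q = q := Real.mul_self_sqrt hq.le
  have hpi : (Real.pi / 2) ^ 2 ≤ 4 := by nlinarith [Real.pi_le_four, Real.pi_pos]
  have hlim : ∀ ε > 0, width T φ ≤ m + 3 * √q * D + ε := by
    intro ε hε
    have hβ : 0 < (Real.log T.card + 1) / ε := by positivity
    -- This `c` makes q and c²D² equal. As (π/2)² ≤ 4, the right side is at most 3q, whence the
    -- constant 3; `β` was chosen to make the smoothing error at most `ε`.
    have hk := key _ hβ (√q / D) (by positivity)
    have hle : Real.log T.card / ((Real.log T.card + 1) / ε) ≤ ε := by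
      rw [div_div_eq_mul_div, div_le_iff₀ (by positivity)]
      nlinarith
    have hk2 : (√q / D * (Real.pi / 2)) ^ 2 * D ^ 2 / 2 ≤ 2 * q := by
      have : (√q / D * (Real.pi / 2)) ^ 2 * D ^ 2 / 2 = (Real.pi / 2) ^ 2 * (√q * √q) / 2 := by
        field_simp
      rw [this, hss]
      nlinarith
    have hk3 : √q / D * (width T φ - (m + Real.log T.card / ((Real.log T.card + 1) / ε))) ≤
        √q / D * (3 * √q * D) := by
      have : √q / D * (3 * √q * D) = 3 * (√q * √q) := by field_simp
      rw [this, hss]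
      linarith
    have := le_of_mul_le_mul_left hk3 (by positivity)
    linarith
  exact le_of_forall_pos_le_add hlim

end Concentration

/-! ### Chaining and the partition scheme -/

lemma one_le_sechTau : 1 ≤ sechTau := by
  have := Real.sqrt_nonneg sechVar
  unfold sechTau
  linarith

/-- This is where the secant law fits B₂ + rB₁: shifts cost quadratically in the ℓ₂ part and
linearly in the ℓ₁ part. -/
lemma cosh_add_le (u v : ℝ) : Real.cosh (u + v) ≤ Real.exp (u ^ 2 / 2 + |v|) := by
  have h1 : Real.cosh (u + v) ≤ Real.cosh u * Real.exp |v| := by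
    rw [Real.cosh_eq, Real.cosh_eq]
    have e1 : Real.exp (u + v) ≤ Real.exp u * Real.exp |v| := by
      rw [Real.exp_add]
      have := Real.exp_le_exp.2 (le_abs_self v)
      gcongr
    have e2 : Real.exp (-(u + v)) ≤ Real.exp (-u) * Real.exp |v| := by
      rw [neg_add, Real.exp_add]
      have := Real.exp_le_exp.2 (neg_le_abs v)
      gcongr
    linarith
  rw [Real.exp_add]
  exact h1.trans (mul_le_mul_of_nonneg_right (Real.cosh_le_exp_half_sq u) (Real.exp_pos _).le)

lemma prod_cosh_le {ι : Type*} [Fintype ι] {x u v : ι → ℝ} (hx : x = u + v) {t a b : ℝ}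
    (ht : 0 < t) (hu : ∑ k, u k ^ 2 ≤ a) (hv : ∑ k, |v k| ≤ b) :
    ∏ k, Real.cosh (t⁻¹ * x k) ≤ Real.exp (t⁻¹ ^ 2 * a / 2 + t⁻¹ * b) := by
  have ht' : 0 < t⁻¹ := inv_pos.2 ht
  calc _ ≤ ∏ k, Real.exp ((t⁻¹ * u k) ^ 2 / 2 + |t⁻¹ * v k|) := by
        refine Finset.prod_le_prod (fun k _ => (Real.cosh_pos _).le) fun k _ => ?_
        rw [hx, Pi.add_apply, mul_add]
        exact cosh_add_le _ _
    _ = Real.exp (t⁻¹ ^ 2 * (∑ k, u k ^ 2) / 2 + t⁻¹ * ∑ k, |v k|) := by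
        rw [← Real.exp_sum, Finset.sum_add_distrib, Finset.mul_sum, Finset.mul_sum,
          Finset.sum_div]
        simp only [mul_pow, abs_mul, abs_of_pos ht']
    _ ≤ _ := by
        gcongr

lemma two_mul_exp_le {q q' : ℝ} (h : q + 1 ≤ q') : 2 * Real.exp q ≤ Real.exp q' := by
  have h1 : (2 : ℝ) ≤ Real.exp 1 := by linarith [Real.add_one_le_exp (1 : ℝ)]
  calc 2 * Real.exp q ≤ Real.exp 1 * Real.exp q := by gcongr
    _ = Real.exp (q + 1) := by rw [Real.exp_add, mul_comm]
    _ ≤ _ := Real.exp_le_exp.2 h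

lemma le_of_forall_le_mul_one_add {w P c : ℝ}
    (h : ∀ m : ℕ, w ≤ P * (1 + c * (1 / 2) ^ m)) : w ≤ P := by
  have h1 : Filter.Tendsto (fun m : ℕ => P * (1 + c * (1 / 2 : ℝ) ^ m)) Filter.atTop
      (nhds (P * (1 + c * 0))) :=
    ((tendsto_pow_atTop_nhds_zero_of_lt_one (by norm_num) (by norm_num)).const_mul c
      |>.const_add 1).const_mul P
  simpa using ge_of_tendsto' h1 h

section Chaining

variable {ι : Type*} [Fintype ι] [DecidableEq ι]
  {E : Type*} [NormedAddCommGroup E] [InnerProductSpace ℝ E] [FiniteDimensional ℝ E]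
  [MeasurableSpace E] [BorelSpace E] {I : Type*}

/-- Dudley's chaining for the linear image of a multiple of the `ℓ₁` ball. -/
lemma width_ballOne_le (z : I → ι → ℝ) {r b : ℝ} (hr : 0 < r) (hz : ∀ i, ∑ k, |z i k| ≤ r)
    (B : (ι → ℝ) →ₗ[ℝ] E) (hb : 0 < b) (hB : hsSq B ≤ b ^ 2) {s D : ℝ} (hs : 0 < s) (hs1 : s ≤ 1)
    (hD : 0 < D) {S : Finset I} (hS : S.Nonempty)
    (hSD : ∀ i ∈ S, ∀ j ∈ S, ‖B (z i) - B (z j)‖ ≤ D) :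
    width S (fun i => B (z i)) ≤ 5 * D / s + 80 * sechTau * b * r * s := by
  set M := ∫ g, ‖g‖ ∂stdGaussian E with hM
  have hM0 : 0 ≤ M := integral_nonneg fun g => norm_nonneg g
  have hτ := sechTau_pos
  -- At m = 0 the factor makes the claim weaker than the crude bound `D * M`. Halving `s` in the
  -- claim for m gives exactly the factor for m + 1, so no terminal scale has to be chosen.
  refine le_of_forall_le_mul_one_add (c := M * s) fun m => ?_
  induction m generalizing s D S with
  | zero =>
    have h1 := width_le_mul_integral_norm hS hSD
    rw [← hM] at h1
    have h2 : D * M ≤ 5 * D / s * (M * s) := by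
      have : 5 * D / s * (M * s) = 5 * (D * M) := by field_simp
      rw [this]
      nlinarith [mul_nonneg hD.le hM0]
    have h3 : 0 ≤ 5 * D / s := by positivity
    have h4 : 0 ≤ 80 * sechTau * b * r * s := by positivity
    have h5 : 0 ≤ M * s := by positivity
    rw [pow_zero, mul_one]
    nlinarith [mul_nonneg h4 h5]
  | succ m ih =>
    set X := 1 + M * s * (1 / 2) ^ (m + 1) with hX
    have hX1 : 1 ≤ X := by
      have : 0 ≤ M * s * (1 / 2) ^ (m + 1) := by positivity
      linarith
    have hs2 : 1 ≤ s⁻¹ ^ 2 := one_le_pow₀ ((one_le_inv₀ hs).2 hs1)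
    -- With t = rs² the translation cost is r/t = s⁻². For the resulting `D'`, the two terms of the
    -- bound at s/2 are each half of the target's second term.
    have ht : 0 < r * s ^ 2 := by positivity
    set D' := 4 * sechTau * (r * s ^ 2) * b with hD'
    have hcov := coveredBy_linear S z (t := r * s ^ 2) (κ := s⁻¹ ^ 2) ht
      (fun i _ => (prod_cosh_le (u := 0) (v := z i) (a := 0) (by simp) ht (by simp)
        (hz i)).trans (Real.exp_le_exp.2 (le_of_eq (by field_simp; ring)))) B hb hB
    have hcov2 : CoveredBy S (Real.exp (2 * s⁻¹ ^ 2)) (fun U => width U (fun i => B (z i)) ≤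
        (5 * D' / (s / 2) + 80 * sechTau * b * r * (s / 2)) * X) := by
      refine hcov.mono (two_mul_exp_le (by linarith)) ?_
      rintro U hUS hU ⟨i, hi, hij⟩
      have := ih (s := s / 2) (D := D') (by positivity) (by linarith) (by positivity) hU
        (fun j hj k hk => by
          have e1 := hij j hj
          have e2 := hij k hk
          rw [map_sub] at e1 e2
          rw [← sub_sub_sub_cancel_right _ _ (B (z i))]
          refine (norm_sub_le _ _).trans ?_
          rw [hD']
          linarith)
      refine this.trans (le_of_eq ?_)
      rw [hX, pow_succ]
      ring
    have h1 := width_le_of_coveredBy hS (by positivity) hD hSD hcov2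
    have h2 : 3 * √(2 * s⁻¹ ^ 2) * D ≤ 5 * D / s := by
      have : √(2 * s⁻¹ ^ 2) ≤ 5 / 3 * s⁻¹ := by
        rw [Real.sqrt_le_left (by positivity)]
        nlinarith [sq_nonneg s⁻¹]
      calc _ ≤ 3 * (5 / 3 * s⁻¹) * D := by gcongr
        _ = _ := by field_simp
    have h3 : 5 * D' / (s / 2) + 80 * sechTau * b * r * (s / 2) =
        80 * sechTau * b * r * s := by
      rw [hD']
      field_simp
      ring
    rw [h3] at h1
    have h4 : 5 * D / s ≤ 5 * D / s * X := le_mul_of_one_le_right (by positivity) hX1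
    calc _ ≤ _ := h1
      _ ≤ 80 * sechTau * b * r * s * X + 5 * D / s * X := by linarith
      _ = _ := by ring

/-- A family in a multiple of the `ℓ₁` ball splits into few pieces of small width. -/
lemma coveredBy_width_ballOne_le (T : Finset I) (z : I → ι → ℝ) {r b : ℝ} (hr : 1 ≤ r)
    (hz : ∀ i, ∑ k, |z i k| ≤ r) (B : (ι → ℝ) →ₗ[ℝ] E) (hb : 0 < b) (hB : hsSq B ≤ b ^ 2) :
    CoveredBy T (Real.exp (2 * r ^ 2))
      (fun S => width S (fun i => B (z i)) ≤ 100 * sechTau * b) := by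
  have hr0 : 0 < r := by linarith
  have hτ := sechTau_pos
  have ht : 0 < r⁻¹ := inv_pos.2 hr0
  have hcov := coveredBy_linear T z (t := r⁻¹) (κ := r ^ 2) ht
    (fun i _ => (prod_cosh_le (u := 0) (v := z i) (a := 0) (by simp) ht (by simp)
      (hz i)).trans (Real.exp_le_exp.2 (le_of_eq (by field_simp; ring)))) B hb hB
  refine hcov.mono (two_mul_exp_le (by nlinarith)) ?_
  rintro U hUS hU ⟨i, hi, hij⟩
  have := width_ballOne_le z hr0 hz B hb hB ht (inv_le_one_of_one_le₀ hr)
    (D := 4 * sechTau * r⁻¹ * b) (by positivity) hU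
    (fun j hj k hk => by
      have e1 := hij j hj
      have e2 := hij k hk
      rw [map_sub] at e1 e2
      rw [← sub_sub_sub_cancel_right _ _ (B (z i))]
      refine (norm_sub_le _ _).trans ?_
      linarith)
  refine this.trans (le_of_eq ?_)
  field_simp
  ring

/-- The linear image of a family in `B₂ + r B₁` whose `ℓ₁` part has small width. -/
lemma width_linear_le {U : Finset I} (hU : U.Nonempty) {x x₁ x₂ : I → ι → ℝ}
    (hx : ∀ i, x i = x₁ i + x₂ i) (hx₁ : ∀ i, ∑ k, x₁ i k ^ 2 ≤ 1)
    (B : (ι → ℝ) →ₗ[ℝ] E) {b w : ℝ} (hb : 0 ≤ b) (hB : hsSq B ≤ b ^ 2)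
    (hw : width U (fun i => B (x₂ i)) ≤ w) : width U (fun i => B (x i)) ≤ b + w := by
  have h1 : width U (fun i => B (x i)) = width U (fun i => B (x₁ i) + B (x₂ i)) :=
    width_congr fun i _ => by rw [hx, map_add]
  rw [h1]
  refine (width_add_le hU _ _).trans (add_le_add ?_ hw)
  exact (width_ball_le hU x₁ (fun i _ => hx₁ i) B).trans ((Real.sqrt_le_left hb).2 hB)

variable {x x₁ x₂ y y₁ y₂ : I → ι → ℝ} {r : ℝ}

/-- One step of the partition scheme: the family is cut into few pieces, each recentred at one of
its points. -/
lemma width_bilinear_step (hr : 1 ≤ r)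
    (hx : ∀ i, x i = x₁ i + x₂ i) (hx₁ : ∀ i, ∑ k, x₁ i k ^ 2 ≤ 1) (hx₂ : ∀ i, ∑ k, |x₂ i k| ≤ r)
    (hy : ∀ i, y i = y₁ i + y₂ i) (hy₁ : ∀ i, ∑ k, y₁ i k ^ 2 ≤ 1) (hy₂ : ∀ i, ∑ k, |y₂ i k| ≤ r)
    (A : (ι → ℝ) →ₗ[ℝ] (ι → ℝ) →ₗ[ℝ] E) {a : ℝ} (ha : 0 < a) (hA : hsSq (hsMap A) ≤ a ^ 2)
    {t h D W : ℝ} (ht : 0 < t) (htr : t * r ≤ 1) (hh : 0 < h) (hD : 0 < D)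
    {c c₁ c₂ d d₁ d₂ : ι → ℝ} (hc : c = c₁ + c₂) (hc₁ : ∑ k, c₁ k ^ 2 ≤ 1)
    (hc₂ : ∑ k, |c₂ k| ≤ r) (hd : d = d₁ + d₂) (hd₁ : ∑ k, d₁ k ^ 2 ≤ 1) (hd₂ : ∑ k, |d₂ k| ≤ r)
    {S : Finset I} (hS : S.Nonempty) (hSx : ∀ i ∈ S, ‖hsMap A (x i - c)‖ ≤ h)
    (hSy : ∀ i ∈ S, ‖hsMap A.flip (y i - d)‖ ≤ h)
    (hSD : ∀ i ∈ S, ∀ j ∈ S, ‖A (x i - c) (y i - d) - A (x j - c) (y j - d)‖ ≤ D)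
    (hW : ∀ i₀ ∈ S, ∀ U ⊆ S, U.Nonempty →
      (∀ i ∈ U, ‖hsMap A (x i - x i₀)‖ ≤ 2 * sechTau * t * a) →
      (∀ i ∈ U, ‖hsMap A.flip (y i - y i₀)‖ ≤ 2 * sechTau * t * a) →
      (∀ i ∈ U, ∀ j ∈ U, ‖A (x i - x i₀) (y i - y i₀) - A (x j - x i₀) (y j - y i₀)‖ ≤
        16 * sechTau * t * h + 4 * sechTau ^ 2 * t ^ 2 * a) →
      width U (fun i => A (x i - x i₀) (y i - y i₀)) ≤ W) :
    width S (fun i => A (x i - c) (y i - d)) ≤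
      W + (2 + 200 * sechTau) * h + 14 * D / t := by
  have hr0 : 0 < r := by linarith
  have hτ := sechTau_pos
  have htinv : 0 < t⁻¹ := inv_pos.2 ht
  have hrt : r ≤ t⁻¹ := by rw [← one_div, le_div_iff₀ ht]; linarith
  have ht1 : 1 ≤ t⁻¹ := hr.trans hrt
  have hq1 : 1 ≤ t⁻¹ ^ 2 := one_le_pow₀ ht1
  have hrtt : t⁻¹ * r ≤ t⁻¹ ^ 2 := by rw [sq]; gcongr
  have hr2 : r ^ 2 ≤ t⁻¹ ^ 2 := by gcongr
  have hsq : ∀ u v : ι → ℝ, ∑ k, u k ^ 2 ≤ 1 → ∑ k, v k ^ 2 ≤ 1 → ∑ k, (u - v) k ^ 2 ≤ 4 := by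
    intro u v hu hv
    calc _ ≤ ∑ k, (2 * u k ^ 2 + 2 * v k ^ 2) := Finset.sum_le_sum fun k _ => by
          rw [Pi.sub_apply]; nlinarith [sq_nonneg (u k + v k)]
      _ ≤ 4 := by rw [Finset.sum_add_distrib, ← Finset.mul_sum, ← Finset.mul_sum]; linarith
  have habs : ∀ u v : ι → ℝ, ∑ k, |u k| ≤ r → ∑ k, |v k| ≤ r → ∑ k, |(u - v) k| ≤ 2 * r := by
    intro u v hu hv
    calc _ ≤ ∑ k, (|u k| + |v k|) := Finset.sum_le_sum fun k _ => by
          rw [Pi.sub_apply]; exact abs_sub _ _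
      _ ≤ 2 * r := by rw [Finset.sum_add_distrib]; linarith
  have hcov1 := coveredBy_bilinear S (fun i => x i - c) (fun i => y i - d) (t := t)
    (κ := 4 * t⁻¹ ^ 2) (κ' := 4 * t⁻¹ ^ 2) (h := h) (a := a) ht
    (fun i _ => (prod_cosh_le (u := x₁ i - c₁) (v := x₂ i - c₂)
      (by rw [hx, hc]; abel) ht (hsq _ _ (hx₁ i) hc₁) (habs _ _ (hx₂ i) hc₂)).trans
        (Real.exp_le_exp.2 (by linarith)))
    (fun i _ => (prod_cosh_le (u := y₁ i - d₁) (v := y₂ i - d₂)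
      (by rw [hy, hd]; abel) ht (hsq _ _ (hy₁ i) hd₁) (habs _ _ (hy₂ i) hd₂)).trans
        (Real.exp_le_exp.2 (by linarith)))
    A hh ha hA hSx hSy
  simp only [sub_sub_sub_cancel_right] at hcov1
  have hcov : CoveredBy S (Real.exp (19 * t⁻¹ ^ 2))
      (fun U => width U (fun i => A (x i - c) (y i - d)) ≤ W + (2 + 200 * sechTau) * h) := by
    refine (hcov1.refine (M := Real.exp (10 * t⁻¹ ^ 2)) (Real.exp_pos _).le
      (R := fun U => width U (fun i => A (x i - c) (y i - d)) ≤ W + (2 + 200 * sechTau) * h)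
      ?_).mono ?_ fun U _ _ hU => hU.1
    · rintro S₁ hS₁ - ⟨i₀, hi₀, hij⟩
      set B₁ := A.flip (y i₀ - d) with hB₁
      set B₂ := A (x i₀ - c) with hB₂
      have hB₁h : hsSq B₁ ≤ h ^ 2 := by
        rw [hB₁, ← norm_hsMap_sq]
        have := hSy i₀ (hS₁ hi₀)
        gcongr
      have hB₂h : hsSq B₂ ≤ h ^ 2 := by
        rw [hB₂, ← norm_hsMap_sq]
        have := hSx i₀ (hS₁ hi₀)
        gcongr
      -- `c1` and `c2` make B₁x and B₂y vary by O(th), which controls the diameter after recentring;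
      -- `c3` and `c4` make the widths of the ℓ₁ parts O(h). All counts are e^{O(t⁻²)} because r ≤
      -- t⁻¹.
      have c1 := coveredBy_linear S₁ x (t := t) (κ := 2 * t⁻¹ ^ 2) ht
        (fun i _ => (prod_cosh_le (hx i) ht (hx₁ i) (hx₂ i)).trans
          (Real.exp_le_exp.2 (by linarith))) B₁ hh hB₁h
      have c2 : ∀ U : Finset I, _ := fun U => coveredBy_linear U y (t := t) (κ := 2 * t⁻¹ ^ 2) ht
        (fun i _ => (prod_cosh_le (hy i) ht (hy₁ i) (hy₂ i)).trans
          (Real.exp_le_exp.2 (by linarith))) B₂ hh hB₂h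
      have c3 : ∀ U : Finset I, _ := fun U => coveredBy_width_ballOne_le U x₂ hr hx₂ B₁ hh hB₁h
      have c4 : ∀ U : Finset I, _ := fun U => coveredBy_width_ballOne_le U y₂ hr hy₂ B₂ hh hB₂h
      have hall := ((c1.refine (by positivity) fun U _ _ _ => c2 U).refine (by positivity)
        fun U _ _ _ => c3 U).refine (by positivity) fun U _ _ _ => c4 U
      refine hall.mono ?_ ?_
      · calc _ = (2 * Real.exp (2 * t⁻¹ ^ 2)) * (2 * Real.exp (2 * t⁻¹ ^ 2)) *
              (Real.exp (2 * r ^ 2) * Real.exp (2 * r ^ 2)) := by ring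
          _ ≤ Real.exp (3 * t⁻¹ ^ 2) * Real.exp (3 * t⁻¹ ^ 2) *
              (Real.exp (2 * t⁻¹ ^ 2) * Real.exp (2 * t⁻¹ ^ 2)) := by
              have := two_mul_exp_le (q := 2 * t⁻¹ ^ 2) (q' := 3 * t⁻¹ ^ 2) (by linarith)
              gcongr
          _ = _ := by
              rw [← Real.exp_add, ← Real.exp_add, ← Real.exp_add]
              congr 1
              ring
      · rintro U hUS₁ hU ⟨hw4, U₃, -, ⟨hw3, U₂, -, ⟨⟨j₂, hj₂, hc2⟩, U₁, -, ⟨j₁, hj₁, hc1⟩, hU₂⟩,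
          hU₃⟩, hUU₃⟩
        have hw3' : width U (fun i => B₁ (x₂ i)) ≤ 100 * sechTau * h :=
          (width_mono hU hUU₃).trans hw3
        have l1 := width_linear_le hU hx hx₁ B₁ hh.le hB₁h hw3'
        have l2 := width_linear_le hU hy hy₁ B₂ hh.le hB₂h hw4
        have hdec : ∀ i, A (x i - c) (y i - d) = A (x i - x i₀) (y i - y i₀) +
            (B₁ (x i) + (B₂ (y i) - (B₁ (x i₀) + B₂ (y i₀) - B₂ (y i₀ - d)))) := by
          intro i
          simp only [hB₁, hB₂, map_sub, LinearMap.sub_apply, LinearMap.flip_apply]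
          abel
        have hwW := hW i₀ (hS₁ hi₀) U (hUS₁.trans hS₁) hU (fun i hi => (hij i (hUS₁ hi)).1)
          (fun i hi => (hij i (hUS₁ hi)).2.1) (fun i hi j hj => by
            have e1 := (hij i (hUS₁ hi)).2.2
            have e2 := (hij j (hUS₁ hj)).2.2
            have f1 := hc1 i (hU₂ (hU₃ (hUU₃ hi)))
            have f2 := hc1 j (hU₂ (hU₃ (hUU₃ hj)))
            have g1 := hc2 i (hU₃ (hUU₃ hi))
            have g2 := hc2 j (hU₃ (hUU₃ hj))
            have e : A (x i - x i₀) (y i - y i₀) - A (x j - x i₀) (y j - y i₀) =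
                ((A (x i - c) (y i - d) - A (x i₀ - c) (y i₀ - d)) -
                  (A (x j - c) (y j - d) - A (x i₀ - c) (y i₀ - d))) -
                (B₁ (x i - x j₁) - B₁ (x j - x j₁)) - (B₂ (y i - y j₂) - B₂ (y j - y j₂)) := by
              rw [hdec i, hdec j]
              simp only [map_sub]
              abel
            rw [e]
            refine (norm_sub_le _ _).trans ((add_le_add ((norm_sub_le _ _).trans (add_le_add
              (norm_sub_le _ _) (norm_sub_le _ _))) (norm_sub_le _ _)).trans ?_)
            linarith)
        rw [show (fun i => A (x i - c) (y i - d)) = fun i => A (x i - x i₀) (y i - y i₀) +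
            (B₁ (x i) + (B₂ (y i) - (B₁ (x i₀) + B₂ (y i₀) - B₂ (y i₀ - d)))) from funext hdec]
        have s1 := width_add_le hU (fun i => A (x i - x i₀) (y i - y i₀))
          (fun i => B₁ (x i) + (B₂ (y i) - (B₁ (x i₀) + B₂ (y i₀) - B₂ (y i₀ - d))))
        have s2 := width_add_le hU (fun i => B₁ (x i))
          (fun i => B₂ (y i) - (B₁ (x i₀) + B₂ (y i₀) - B₂ (y i₀ - d)))
        have s3 := width_sub_const hU (fun i => B₂ (y i)) (B₁ (x i₀) + B₂ (y i₀) - B₂ (y i₀ - d))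
        linarith
    · calc _ ≤ Real.exp (9 * t⁻¹ ^ 2) * Real.exp (10 * t⁻¹ ^ 2) := by
            have := two_mul_exp_le (q := 4 * t⁻¹ ^ 2 + 4 * t⁻¹ ^ 2) (q' := 9 * t⁻¹ ^ 2)
              (by linarith)
            gcongr
        _ = _ := by
            rw [← Real.exp_add]
            congr 1
            ring
  have h1 := width_le_of_coveredBy hS (by positivity) hD hSD hcov
  have h2 : 3 * √(19 * t⁻¹ ^ 2) * D ≤ 14 * D / t := by
    -- The exponent 19 is 9 for the bilinear covering plus 3 + 3 + 2 + 2 for the four linear ones.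
    have : √(19 * t⁻¹ ^ 2) ≤ 14 / 3 * t⁻¹ := by
      rw [Real.sqrt_le_left (by positivity)]
      nlinarith [sq_nonneg t⁻¹]
    calc _ ≤ 3 * (14 / 3 * t⁻¹) * D := by gcongr
      _ = _ := by field_simp
  linarith

/-- The iterated partition scheme. -/
lemma width_bilinear_le (hr : 1 ≤ r)
    (hx : ∀ i, x i = x₁ i + x₂ i) (hx₁ : ∀ i, ∑ k, x₁ i k ^ 2 ≤ 1) (hx₂ : ∀ i, ∑ k, |x₂ i k| ≤ r)
    (hy : ∀ i, y i = y₁ i + y₂ i) (hy₁ : ∀ i, ∑ k, y₁ i k ^ 2 ≤ 1) (hy₂ : ∀ i, ∑ k, |y₂ i k| ≤ r)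
    (A : (ι → ℝ) →ₗ[ℝ] (ι → ℝ) →ₗ[ℝ] E) {a : ℝ} (ha : 0 < a) (hA : hsSq (hsMap A) ≤ a ^ 2)
    {t h D : ℝ} (ht : 0 < t) (htr : t * r ≤ 1) (hh : 0 < h) (hD : 0 < D)
    {c c₁ c₂ d d₁ d₂ : ι → ℝ} (hc : c = c₁ + c₂) (hc₁ : ∑ k, c₁ k ^ 2 ≤ 1)
    (hc₂ : ∑ k, |c₂ k| ≤ r) (hd : d = d₁ + d₂) (hd₁ : ∑ k, d₁ k ^ 2 ≤ 1) (hd₂ : ∑ k, |d₂ k| ≤ r)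
    {S : Finset I} (hS : S.Nonempty) (hSx : ∀ i ∈ S, ‖hsMap A (x i - c)‖ ≤ h)
    (hSy : ∀ i ∈ S, ‖hsMap A.flip (y i - d)‖ ≤ h)
    (hSD : ∀ i ∈ S, ∀ j ∈ S, ‖A (x i - c) (y i - d) - A (x j - c) (y j - d)‖ ≤ D) :
    width S (fun i => A (x i - c) (y i - d)) ≤
      650 * sechTau ^ 2 * h + 14 * D / t + 3500 * sechTau ^ 3 * (t * a) := by
  set M := ∫ g, ‖g‖ ∂stdGaussian E with hM
  have hM0 : 0 ≤ M := integral_nonneg fun g => norm_nonneg g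
  have hτ := sechTau_pos
  have hτ1 := one_le_sechTau
  refine le_of_forall_le_mul_one_add (c := M * t) fun m => ?_
  induction m generalizing t h D c c₁ c₂ d d₁ d₂ S with
  | zero =>
    have h1 := width_le_mul_integral_norm hS hSD
    rw [← hM] at h1
    have h2 : D * M ≤ 14 * D / t * (M * t) := by
      have : 14 * D / t * (M * t) = 14 * (D * M) := by field_simp
      rw [this]
      nlinarith [mul_nonneg hD.le hM0]
    have h3 : 0 ≤ 14 * D / t := by positivity
    have h4 : 0 ≤ 650 * sechTau ^ 2 * h + 3500 * sechTau ^ 3 * (t * a) := by positivity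
    have h5 : 0 ≤ M * t := by positivity
    rw [pow_zero, mul_one]
    nlinarith [mul_nonneg h4 h5]
  | succ m ih =>
    set X := 1 + M * t * (1 / 2) ^ (m + 1) with hX
    have hX1 : 1 ≤ X := by
      have : 0 ≤ M * t * (1 / 2) ^ (m + 1) := by positivity
      linarith
    set h' := 2 * sechTau * t * a with hh'
    set D' := 16 * sechTau * t * h + 4 * sechTau ^ 2 * t ^ 2 * a with hD'
    have hstep := width_bilinear_step (W := (650 * sechTau ^ 2 * h' + 14 * D' / (t / 2) +
      3500 * sechTau ^ 3 * (t / 2 * a)) * X) hr hx hx₁ hx₂ hy hy₁ hy₂ A ha hA ht htr hh hD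
      hc hc₁ hc₂ hd hd₁ hd₂ hS hSx hSy hSD (fun i₀ hi₀ U hU hUne hUx hUy hUD => by
        refine (ih (t := t / 2) (by positivity) (by nlinarith) (by positivity) (by positivity)
          (hx i₀) (hx₁ i₀) (hx₂ i₀) (hy i₀) (hy₁ i₀) (hy₂ i₀) hUne hUx hUy hUD).trans
          (le_of_eq ?_)
        rw [hX, pow_succ]
        ring)
    -- The self-reproduction of the bound: 448 + 200 + 2 = 650 for `h`, and 3050 + 112 ≤ 3500 for `t
    -- * a`, using 1 ≤ `sechTau`.
    have e1 : 650 * sechTau ^ 2 * h' + 14 * D' / (t / 2) + 3500 * sechTau ^ 3 * (t / 2 * a) =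
        (448 * sechTau) * h + (3050 * sechTau ^ 3 + 112 * sechTau ^ 2) * (t * a) := by
      rw [hh', hD']
      field_simp
      ring
    have hτ2 : sechTau ≤ sechTau ^ 2 := by nlinarith
    have hτ3 : sechTau ^ 2 ≤ sechTau ^ 3 := by nlinarith [sq_nonneg sechTau]
    have hta : 0 < t * a := by positivity
    have e2 : 650 * sechTau ^ 2 * h' + 14 * D' / (t / 2) + 3500 * sechTau ^ 3 * (t / 2 * a) +
        (2 + 200 * sechTau) * h + 14 * D / t ≤
        650 * sechTau ^ 2 * h + 14 * D / t + 3500 * sechTau ^ 3 * (t * a) := by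
      rw [e1]
      have f1 : (448 * sechTau + (2 + 200 * sechTau)) * h ≤ 650 * sechTau ^ 2 * h := by
        gcongr
        nlinarith
      have f2 : (3050 * sechTau ^ 3 + 112 * sechTau ^ 2) * (t * a) ≤
          3500 * sechTau ^ 3 * (t * a) := by
        gcongr
        nlinarith
      linarith
    have e3 : 0 ≤ (2 + 200 * sechTau) * h + 14 * D / t := by positivity
    calc _ ≤ _ := hstep
      _ ≤ (650 * sechTau ^ 2 * h' + 14 * D' / (t / 2) + 3500 * sechTau ^ 3 * (t / 2 * a) +
        ((2 + 200 * sechTau) * h + 14 * D / t)) * X := by nlinarith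
      _ ≤ _ := by
        refine mul_le_mul_of_nonneg_right ?_ (by linarith)
        linarith

end Chaining

/-! ### The chaos as a bilinear map, and passage to infinite families -/

section Chaos

variable {n : ℕ} (a : Fin n → Fin n → Fin n → ℝ)

/-- The bilinear map `(x, y) ↦ (∑ᵢⱼ aᵢⱼₖ xᵢ yⱼ)ₖ`. -/
def bilinOf : (Fin n → ℝ) →ₗ[ℝ] (Fin n → ℝ) →ₗ[ℝ] EuclideanSpace ℝ (Fin n) :=
  LinearMap.mk₂ ℝ (fun x y => WithLp.toLp 2 fun k => ∑ i, ∑ j, a i j k * (x i * y j))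
    (fun x x' y => by
      ext k
      simp only [Pi.add_apply, PiLp.add_apply, ← Finset.sum_add_distrib]
      exact Finset.sum_congr rfl fun i _ => Finset.sum_congr rfl fun j _ => by ring)
    (fun c x y => by
      ext k
      simp only [Pi.smul_apply, PiLp.smul_apply, smul_eq_mul, Finset.mul_sum]
      exact Finset.sum_congr rfl fun i _ => Finset.sum_congr rfl fun j _ => by ring)
    (fun x y y' => by
      ext k
      simp only [Pi.add_apply, PiLp.add_apply, ← Finset.sum_add_distrib]
      exact Finset.sum_congr rfl fun i _ => Finset.sum_congr rfl fun j _ => by ring)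
    (fun c x y => by
      ext k
      simp only [Pi.smul_apply, PiLp.smul_apply, smul_eq_mul, Finset.mul_sum]
      exact Finset.sum_congr rfl fun i _ => Finset.sum_congr rfl fun j _ => by ring)

lemma bilinOf_apply (x y : Fin n → ℝ) (k : Fin n) :
    bilinOf a x y k = ∑ i, ∑ j, a i j k * (x i * y j) := rfl

lemma norm_bilinOf_sub (x y x' y' : Fin n → ℝ) :
    ‖bilinOf a x y - bilinOf a x' y'‖ =
      √(∑ k, (∑ i, ∑ j, a i j k * (x i * y j - x' i * y' j)) ^ 2) := by
  rw [EuclideanSpace.norm_eq]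
  congr 1
  refine Finset.sum_congr rfl fun k _ => ?_
  rw [Real.norm_eq_abs, sq_abs, PiLp.sub_apply, bilinOf_apply, bilinOf_apply,
    ← Finset.sum_sub_distrib]
  simp only [← Finset.sum_sub_distrib, mul_sub]

lemma norm_hsMap_bilinOf (x : Fin n → ℝ) :
    ‖hsMap (bilinOf a) x‖ = √(∑ j, ∑ k, (∑ i, a i j k * x i) ^ 2) := by
  rw [← Real.sqrt_sq (norm_nonneg _), norm_hsMap_sq, hsSq]
  simp only [EuclideanSpace.real_norm_sq_eq, bilinOf_apply]
  congr 1
  refine Finset.sum_congr rfl fun j _ => Finset.sum_congr rfl fun k _ => ?_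
  congr 1
  exact Finset.sum_congr rfl fun i _ => by simp [Pi.single_apply]

lemma norm_hsMap_flip_bilinOf (y : Fin n → ℝ) :
    ‖hsMap (bilinOf a).flip y‖ = √(∑ i, ∑ k, (∑ j, a i j k * y j) ^ 2) := by
  rw [← Real.sqrt_sq (norm_nonneg _), norm_hsMap_sq, hsSq]
  simp only [EuclideanSpace.real_norm_sq_eq, LinearMap.flip_apply, bilinOf_apply]
  congr 1
  refine Finset.sum_congr rfl fun j _ => Finset.sum_congr rfl fun k _ => ?_
  congr 1
  rw [Finset.sum_comm]
  exact Finset.sum_congr rfl fun i _ => by simp [Pi.single_apply]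

lemma hsSq_hsMap_bilinOf : hsSq (hsMap (bilinOf a)) = hsNorm a ^ 2 := by
  rw [hsNorm, Real.sq_sqrt (by positivity), hsSq]
  refine Finset.sum_congr rfl fun i _ => ?_
  rw [norm_hsMap_bilinOf, Real.sq_sqrt (by positivity)]
  refine Finset.sum_congr rfl fun j _ => Finset.sum_congr rfl fun k _ => ?_
  simp [Pi.single_apply]

lemma inner_bilinOf (x y : Fin n → ℝ) (v : EuclideanSpace ℝ (Fin n)) :
    inner ℝ (bilinOf a x y) v = ∑ i, ∑ j, ∑ k, a i j k * x i * y j * v k := by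
  rw [PiLp.inner_apply]
  simp only [bilinOf_apply, RCLike.inner_apply, conj_trivial, Finset.mul_sum]
  rw [Finset.sum_comm]
  refine Finset.sum_congr rfl fun i _ => ?_
  rw [Finset.sum_comm]
  exact Finset.sum_congr rfl fun j _ => Finset.sum_congr rfl fun k _ => by ring

lemma exists_split_of_mem_sumBall {p : ℝ} {x : Fin n → ℝ} (hx : x ∈ sumBall n p) :
    ∃ u v : Fin n → ℝ, x = u + v ∧ ∑ k, u k ^ 2 ≤ 1 ∧ ∑ k, |v k| ≤ √p := by
  obtain ⟨u, hu, v, ⟨w, hw, rfl⟩, rfl⟩ := hx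
  refine ⟨u, √p • w, rfl, ?_, ?_⟩
  · have hu' : √(∑ i, u i ^ 2) ≤ 1 := hu
    rwa [Real.sqrt_le_left zero_le_one, one_pow] at hu'
  · have hw' : ∑ i, |w i| ≤ 1 := hw
    simp only [Pi.smul_apply, smul_eq_mul, abs_mul, abs_of_nonneg (Real.sqrt_nonneg p),
      ← Finset.mul_sum]
    exact mul_le_of_le_one_right (Real.sqrt_nonneg p) hw'

lemma sumBall_subset_closedBall (n : ℕ) (p : ℝ) :
    sumBall n p ⊆ Metric.closedBall 0 (1 + √p) := by
  intro x hx
  obtain ⟨u, v, rfl, hu, hv⟩ := exists_split_of_mem_sumBall hx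
  rw [mem_closedBall_zero_iff, pi_norm_le_iff_of_nonneg (by positivity)]
  intro k
  rw [Pi.add_apply]
  refine (norm_add_le _ _).trans (add_le_add ?_ ?_)
  · rw [Real.norm_eq_abs]
    have h1 := Finset.single_le_sum (f := fun k => u k ^ 2) (fun k _ => sq_nonneg _)
      (Finset.mem_univ k)
    exact abs_le_one_iff_mul_self_le_one.2 (by nlinarith)
  · exact (Finset.single_le_sum (f := fun k => |v k|) (fun k _ => abs_nonneg _)
      (Finset.mem_univ k)).trans hv

variable {a} {p : ℝ} {T : Set ((Fin n → ℝ) × (Fin n → ℝ))}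

/-- Ensures that the real suprema in `diam`, `sTwo` and `supForm` are genuine and not the default
value 0 of an unbounded family. -/
lemma exists_bound_on (hT : T ⊆ sumBall n p ×ˢ sumBall n p)
    {f : (Fin n → ℝ) × (Fin n → ℝ) → ℝ} (hf : Continuous f) : ∃ R, ∀ z ∈ T, f z ≤ R := by
  have hK : IsCompact ((Metric.closedBall (0 : Fin n → ℝ) (1 + √p)) ×ˢ
      (Metric.closedBall (0 : Fin n → ℝ) (1 + √p))) :=
    (isCompact_closedBall _ _).prod (isCompact_closedBall _ _)
  obtain ⟨R, hR⟩ := hK.bddAbove_image hf.continuousOn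
  refine ⟨R, fun z hz => hR ⟨z, ?_, rfl⟩⟩
  exact ⟨sumBall_subset_closedBall n p (hT hz).1, sumBall_subset_closedBall n p (hT hz).2⟩

lemma norm_bilinOf_sub_le_diam (hT : T ⊆ sumBall n p ×ˢ sumBall n p) (z w : T) :
    ‖bilinOf a z.1.1 z.1.2 - bilinOf a w.1.1 w.1.2‖ ≤ diam a T := by
  obtain ⟨R, hR⟩ := exists_bound_on hT (continuous_bilin_pi (bilinOf a)).norm
  have hb : BddAbove (Set.range fun q : T × T => √(∑ k, (∑ i, ∑ j, a i j k *
      (q.1.1.1 i * q.1.1.2 j - q.2.1.1 i * q.2.1.2 j)) ^ 2)) := by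
    refine ⟨R + R, ?_⟩
    rintro _ ⟨q, rfl⟩
    change √(∑ k, (∑ i, ∑ j, a i j k *
      (q.1.1.1 i * q.1.1.2 j - q.2.1.1 i * q.2.1.2 j)) ^ 2) ≤ R + R
    rw [← norm_bilinOf_sub]
    exact (norm_sub_le _ _).trans (add_le_add (hR _ q.1.2) (hR _ q.2.2))
  rw [norm_bilinOf_sub]
  exact le_ciSup hb (z, w)

lemma norm_hsMap_add_le_sTwo (hT : T ⊆ sumBall n p ×ˢ sumBall n p) (z : T) :
    ‖hsMap (bilinOf a) z.1.1‖ + ‖hsMap (bilinOf a).flip z.1.2‖ ≤ sTwo a T := by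
  obtain ⟨R, hR⟩ := exists_bound_on hT
    (((continuous_linearMap_pi (hsMap (bilinOf a))).comp continuous_fst).norm.add
      ((continuous_linearMap_pi (hsMap (bilinOf a).flip)).comp continuous_snd).norm)
  have hb : BddAbove (Set.range fun z : T => √(∑ j, ∑ k, (∑ i, a i j k * z.1.1 i) ^ 2) +
      √(∑ i, ∑ k, (∑ j, a i j k * z.1.2 j) ^ 2)) := by
    refine ⟨R, ?_⟩
    rintro _ ⟨z, rfl⟩
    have := hR z.1 z.2
    simp only [Function.comp_apply, norm_hsMap_bilinOf, norm_hsMap_flip_bilinOf] at this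
    exact this
  rw [norm_hsMap_bilinOf, norm_hsMap_flip_bilinOf]
  exact le_ciSup hb z

lemma supForm_ofLp (v : EuclideanSpace ℝ (Fin n)) :
    supForm a T v.ofLp = ⨆ z : T, inner ℝ (bilinOf a z.1.1 z.1.2) v := by
  simp only [inner_bilinOf]
  rfl

lemma bddAbove_inner (hT : T ⊆ sumBall n p ×ˢ sumBall n p) (v : EuclideanSpace ℝ (Fin n)) :
    BddAbove (Set.range fun z : T => (inner ℝ (bilinOf a z.1.1 z.1.2) v : ℝ)) := by
  obtain ⟨R, hR⟩ := exists_bound_on hT (continuous_bilin_pi (bilinOf a)).norm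
  refine ⟨R * ‖v‖, ?_⟩
  rintro _ ⟨z, rfl⟩
  exact (real_inner_le_norm _ _).trans
    (mul_le_mul_of_nonneg_right (hR _ z.2) (norm_nonneg _))

/-- `T` may be uncountable; measurability comes from lower semicontinuity of a supremum of
continuous functions. -/
lemma measurable_supForm_ofLp (hT : T ⊆ sumBall n p ×ˢ sumBall n p) :
    Measurable fun v : EuclideanSpace ℝ (Fin n) => supForm a T v.ofLp := by
  simp_rw [supForm_ofLp]
  refine LowerSemicontinuous.measurable (lowerSemicontinuous_ciSup (bddAbove_inner hT)
    fun z => Continuous.lowerSemicontinuous ?_)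
  fun_prop

lemma integrable_supForm_ofLp (hT : T ⊆ sumBall n p ×ˢ sumBall n p) :
    Integrable (fun v : EuclideanSpace ℝ (Fin n) => supForm a T v.ofLp)
      (stdGaussian (EuclideanSpace ℝ (Fin n))) := by
  obtain ⟨R, hR⟩ := exists_bound_on hT (continuous_bilin_pi (bilinOf a)).norm
  have hi : Integrable (fun v : EuclideanSpace ℝ (Fin n) => |R| * ‖v‖)
      (stdGaussian (EuclideanSpace ℝ (Fin n))) := IsGaussian.integrable_id.norm.const_mul _
  refine hi.mono' (measurable_supForm_ofLp hT).aestronglyMeasurable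
    (Filter.Eventually.of_forall fun v => ?_)
  have hle : ∀ z : T, |(inner ℝ (bilinOf a z.1.1 z.1.2) v : ℝ)| ≤ |R| * ‖v‖ := fun z =>
    (abs_real_inner_le_norm _ _).trans
      (mul_le_mul_of_nonneg_right ((hR _ z.2).trans (le_abs_self R)) (norm_nonneg _))
  rw [supForm_ofLp, Real.norm_eq_abs]
  rcases isEmpty_or_nonempty T with hE | ⟨⟨z⟩⟩
  · rw [Real.iSup_of_isEmpty, abs_zero]
    positivity
  · have : Nonempty T := ⟨z⟩
    rw [abs_le]
    exact ⟨(neg_le_neg (hle z)).trans ((neg_abs_le _).trans (le_ciSup (bddAbove_inner hT v) z)),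
      ciSup_le fun w => (le_abs_self _).trans (hle w)⟩

/-- The width of a finite subfamily of `T`. -/
lemma width_finset_le (hp : 2 ≤ p) (hT : T ⊆ sumBall n p ×ˢ sumBall n p) {S : Finset T}
    (hS : S.Nonempty) {δ : ℝ} (hδ : 0 < δ) :
    width S (fun z : T => bilinOf a z.1.1 z.1.2) ≤
      650 * sechTau ^ 2 * (sTwo a T + δ) + 14 * √p * (diam a T + δ) +
        3500 * sechTau ^ 3 * (1 / √p * (hsNorm a + δ)) := by
  have hsp : 1 ≤ √p := Real.one_le_sqrt.2 (by linarith)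
  choose x₁ x₂ hx hx₁ hx₂ using fun z : T => exists_split_of_mem_sumBall (hT z.2).1
  choose y₁ y₂ hy hy₁ hy₂ using fun z : T => exists_split_of_mem_sumBall (hT z.2).2
  obtain ⟨z₀, hz₀⟩ := hS
  have hs0 : 0 ≤ sTwo a T := le_trans (by positivity) (norm_hsMap_add_le_sTwo hT z₀)
  have hD0 : 0 ≤ diam a T := le_trans (norm_nonneg _) (norm_bilinOf_sub_le_diam (a := a) hT z₀ z₀)
  have ha0 : 0 ≤ hsNorm a := Real.sqrt_nonneg _
  -- The scheme starts at centre 0 = 0 + 0 and scale t = 1/√p, so that t r = 1. Adding `δ` supplies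
  -- the strict positivity that it needs.
  have h := width_bilinear_le (x := fun z : T => z.1.1) (y := fun z : T => z.1.2) hsp hx hx₁ hx₂
    hy hy₁ hy₂ (bilinOf a) (a := hsNorm a + δ) (t := 1 / √p) (h := sTwo a T + δ)
    (D := diam a T + δ) (c := 0) (c₁ := 0) (c₂ := 0) (d := 0) (d₁ := 0) (d₂ := 0) (S := S)
    (by positivity) (by rw [hsSq_hsMap_bilinOf]; gcongr; linarith) (by positivity)
    (le_of_eq (by field_simp)) (by positivity) (by positivity)
    (by simp) (by simp) (by simp) (by simp) (by simp) (by simp) ⟨z₀, hz₀⟩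
    (fun z _ => by
      rw [sub_zero]
      linarith [norm_hsMap_add_le_sTwo (a := a) hT z, norm_nonneg (hsMap (bilinOf a).flip z.1.2)])
    (fun z _ => by
      rw [sub_zero]
      linarith [norm_hsMap_add_le_sTwo (a := a) hT z, norm_nonneg (hsMap (bilinOf a) z.1.1)])
    (fun z _ w _ => by
      simp only [sub_zero]
      linarith [norm_bilinOf_sub_le_diam (a := a) hT z w])
  simp only [sub_zero] at h
  refine h.trans (le_of_eq ?_)
  field_simp

lemma exists_finset_net (hT : T ⊆ sumBall n p ×ˢ sumBall n p) [Nonempty T] {ε : ℝ} (hε : 0 < ε) :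
    ∃ S : Finset T, S.Nonempty ∧
      ∀ z : T, ∃ w ∈ S, ‖bilinOf a z.1.1 z.1.2 - bilinOf a w.1.1 w.1.2‖ ≤ ε := by
  classical
  obtain ⟨R, hR⟩ := exists_bound_on hT (continuous_bilin_pi (bilinOf a)).norm
  set φ : T → EuclideanSpace ℝ (Fin n) := fun z => bilinOf a z.1.1 z.1.2 with hφ
  have hb : TotallyBounded (Set.range φ) := by
    refine (isCompact_closedBall (0 : EuclideanSpace ℝ (Fin n)) R).totallyBounded.subset ?_
    rintro _ ⟨z, rfl⟩
    rw [mem_closedBall_zero_iff]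
    exact hR _ z.2
  obtain ⟨s, hs, hfin, hcov⟩ := Metric.finite_approx_of_totallyBounded hb ε hε
  choose! pre hpre using fun v (hv : v ∈ s) => hs hv
  have hnet : ∀ z : T, ∃ w ∈ hfin.toFinset.image pre, ‖φ z - φ w‖ ≤ ε := by
    intro z
    obtain ⟨v, hv, hzv⟩ := Set.mem_iUnion₂.1 (hcov ⟨z, rfl⟩)
    refine ⟨pre v, Finset.mem_image_of_mem _ (hfin.mem_toFinset.2 hv), ?_⟩
    rw [hpre v hv, ← dist_eq_norm]
    exact (Metric.mem_ball.1 hzv).le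
  refine ⟨hfin.toFinset.image pre, ?_, hnet⟩
  obtain ⟨w, hw, -⟩ := hnet (Classical.arbitrary T)
  exact ⟨w, hw⟩

lemma integral_supForm_ofLp_le (hp : 2 ≤ p) (hT : T ⊆ sumBall n p ×ˢ sumBall n p) :
    ∫ v : EuclideanSpace ℝ (Fin n), supForm a T v.ofLp ∂stdGaussian (EuclideanSpace ℝ (Fin n)) ≤
      3500 * sechTau ^ 3 * (√p * diam a T + sTwo a T + 1 / √p * hsNorm a) := by
  have hsp : 1 ≤ √p := Real.one_le_sqrt.2 (by linarith)
  have hτ1 := one_le_sechTau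
  have hτ := sechTau_pos
  have ha0 : 0 ≤ hsNorm a := Real.sqrt_nonneg _
  have hs0 : 0 ≤ sTwo a T := Real.iSup_nonneg fun z => by positivity
  have hD0 : 0 ≤ diam a T := Real.iSup_nonneg fun z => by positivity
  rcases isEmpty_or_nonempty T with hE | hne
  · simp_rw [supForm_ofLp, Real.iSup_of_isEmpty]
    rw [integral_zero]
    positivity
  set M := ∫ g, ‖g‖ ∂stdGaussian (EuclideanSpace ℝ (Fin n)) with hM
  have hM0 : 0 ≤ M := integral_nonneg fun g => norm_nonneg g
  -- Total coefficient of `δ`: the three perturbed parameters plus the net error. It may depend on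
  -- `n` and `p`, since `δ` tends to 0.
  set K := 650 * sechTau ^ 2 + 14 * √p + 3500 * sechTau ^ 3 * (1 / √p) + M with hK
  have hK0 : 0 < K := by positivity
  have key : ∀ δ > 0, ∫ v : EuclideanSpace ℝ (Fin n), supForm a T v.ofLp
      ∂stdGaussian (EuclideanSpace ℝ (Fin n)) ≤
      3500 * sechTau ^ 3 * (√p * diam a T + sTwo a T + 1 / √p * hsNorm a) + K * δ := by
    intro δ hδ
    obtain ⟨S, hS, hnet⟩ := exists_finset_net (a := a) hT hδ
    have hi1 := integrable_supInner hS (fun z : T => bilinOf a z.1.1 z.1.2)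
    have hi2 : Integrable (fun v : EuclideanSpace ℝ (Fin n) => δ * ‖v‖)
      (stdGaussian (EuclideanSpace ℝ (Fin n))) := IsGaussian.integrable_id.norm.const_mul δ
    have h1 : ∫ v : EuclideanSpace ℝ (Fin n), supForm a T v.ofLp
        ∂stdGaussian (EuclideanSpace ℝ (Fin n)) ≤
        width S (fun z : T => bilinOf a z.1.1 z.1.2) + δ * M := by
      rw [width, hM, ← integral_const_mul, ← integral_add hi1 hi2]
      refine integral_mono (integrable_supForm_ofLp hT) (hi1.add hi2) fun v => ?_
      simp only [supForm_ofLp]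
      refine ciSup_le fun z => ?_
      obtain ⟨w, hw, hzw⟩ := hnet z
      have e1 : (inner ℝ (bilinOf a z.1.1 z.1.2) v : ℝ) = inner ℝ (bilinOf a w.1.1 w.1.2) v +
          inner ℝ (bilinOf a z.1.1 z.1.2 - bilinOf a w.1.1 w.1.2) v := by
        rw [inner_sub_left]; ring
      rw [e1]
      exact add_le_add (le_supInner (φ := fun z : T => bilinOf a z.1.1 z.1.2) hw v)
        ((real_inner_le_norm _ _).trans (mul_le_mul_of_nonneg_right hzw (norm_nonneg _)))
    have h2 := width_finset_le (a := a) hp hT hS hδ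
    have hτ3 : sechTau ^ 2 ≤ sechTau ^ 3 := by nlinarith [sq_nonneg sechTau]
    have hτ4 : 1 ≤ sechTau ^ 3 := one_le_pow₀ hτ1
    have f1 : 650 * sechTau ^ 2 * sTwo a T ≤ 3500 * sechTau ^ 3 * sTwo a T := by
      gcongr
      linarith
    have f2 : 14 * (√p * diam a T) ≤ 3500 * sechTau ^ 3 * (√p * diam a T) := by
      gcongr
      linarith
    rw [hK]
    linarith
  refine le_of_forall_pos_le_add fun ε hε => ?_
  have := key (ε / K) (by positivity)
  rwa [mul_div_cancel₀ _ hK0.ne'] at this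

end Chaos

end GaussianChaos

end

/-! ### Transfer from the canonical Gaussian measure to arbitrary independent Gaussians -/

theorem mainTheorem6 :
    ∃ L : ℝ, 0 < L ∧
      ∀ (n : ℕ) (p : ℝ), 2 ≤ p →
      ∀ (a : Fin n → Fin n → Fin n → ℝ) (T : Set ((Fin n → ℝ) × (Fin n → ℝ))),
        T ⊆ GaussianChaos.sumBall n p ×ˢ GaussianChaos.sumBall n p →
      ∀ (Ω : Type*) [MeasurableSpace Ω] (P : Measure Ω) [IsProbabilityMeasure P]
        (g : Fin n → Ω → ℝ), iIndepFun g P →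
        (∀ k, HasLaw (g k) (gaussianReal 0 1) P) →
        Integrable (fun ω => GaussianChaos.supForm a T (fun k => g k ω)) P ∧
        ∫ ω, GaussianChaos.supForm a T (fun k => g k ω) ∂P ≤
          L * (√p * GaussianChaos.diam a T + GaussianChaos.sTwo a T +
            1 / √p * GaussianChaos.hsNorm a) := by
  refine ⟨3500 * GaussianChaos.sechTau ^ 3, mul_pos (by norm_num)
    (pow_pos GaussianChaos.sechTau_pos 3), ?_⟩
  intro n p hp a T hT Ω _ P _ g hind hg
  have hgm : ∀ k, AEMeasurable (g k) P := fun k => (hg k).aemeasurable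
  have hjoint : AEMeasurable (fun ω k => g k ω) P := aemeasurable_pi_lambda _ hgm
  have hlaw : P.map (fun ω k => g k ω) = Measure.pi fun _ : Fin n => gaussianReal 0 1 := by
    rw [(iIndepFun_iff_map_fun_eq_pi_map hgm).1 hind]
    simp_rw [fun k => (hg k).map_eq]
  have htoLp : Measurable (WithLp.toLp 2 : (Fin n → ℝ) → EuclideanSpace ℝ (Fin n)) := by fun_prop
  have hΦ : AEMeasurable (fun ω => (WithLp.toLp 2 fun k => g k ω : EuclideanSpace ℝ (Fin n))) P :=
    htoLp.comp_aemeasurable hjoint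
  -- Independence enters only here: the joint law is the product of one-dimensional Gaussians, that
  -- is, the standard Gaussian of Euclidean space.
  have hΦlaw : P.map (fun ω => (WithLp.toLp 2 fun k => g k ω : EuclideanSpace ℝ (Fin n))) =
      stdGaussian (EuclideanSpace ℝ (Fin n)) := by
    rw [← map_pi_eq_stdGaussian, ← hlaw,
      AEMeasurable.map_map_of_aemeasurable htoLp.aemeasurable hjoint]
    rfl
  have hm := GaussianChaos.measurable_supForm_ofLp (a := a) hT
  have hint := GaussianChaos.integrable_supForm_ofLp (a := a) hT
  have hle := GaussianChaos.integral_supForm_ofLp_le (a := a) hp hT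
  rw [← hΦlaw] at hint hle
  rw [integrable_map_measure hm.aestronglyMeasurable hΦ] at hint
  rw [integral_map hΦ hm.aestronglyMeasurable] at hle
  exact ⟨hint, hle⟩
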